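/- Let $d\ge 1$ be an integer, let $\beta=s+r$ with $s\in\mathbb{N}_0=\{0,1,2,\dots\}$ and $r\in(0,1]$ (so $s$ is the largest integer strictly smaller than $\beta$), and let $B_0>0$. Let $\mathcal{H}^\beta([0,1]^d,B_0)$ be the class of functions $f:[0,1]^d\to\mathbb{R}$ of class $C^s$ (with one-sided derivatives at the boundary) such that $$\max_{\|\alpha\|_1\le s}\ \sup_{x\in[0,1]^d}|\partial^\alpha f(x)|\le B_0,\qquad \max_{\|\alpha\|_1=s}\ \sup_{x\ne y}\frac{|\partial^\alpha f(x)-\partial^\alpha f(y)|}{\|x-y\|_2^{r}}\le B_0,$$ where $\alpha\in\mathbb{N}_0^d$, $\|\alpha\|_1=\sum_{i=1}^d\alpha_i$ and $\partial^\alpha=\partial_1^{\alpha_1}\cdots\partial_d^{\alpha_d}$. A ReLU network with depth $\mathcal{D}$ and width $\mathcal{W}$ is a function $\phi=\mathcal{L}_{\mathcal{D}}\circ\sigma\circ\mathcal{L}_{\mathcal{D}-1}\circ\sigma\circ\cdots\circ\sigma\circ\mathcal{L}_0:\mathbb{R}^d\to\mathbb{R}$, where $\mathcal{L}_i:\mathbb{R}^{p_i}\to\mathbb{R}^{p_{i+1}}$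 are affine maps, $p_0=d$, $p_{\mathcal{D}+1}=1$, $\sigma(t)=\max(0,t)$ acts componentwise, and $\mathcal{W}=\max\{p_1,\dots,p_{\mathcal{D}}\}$. Let $f\in\mathcal{H}^\beta([0,1]^d,B_0)$. Then for all positive integers $M,N$ there exists a function $\phi$ implemented by a ReLU network with width $$\mathcal{W}=38(s+1)^2\,3^d\,d^{\,s+1}N\lceil\log_2(8N)\rceil$$ and depth $$\mathcal{D}=21(s+1)^2M\lceil\log_2(8M)\rceil+2d$$ such that for every $x\in[0,1]^d$ $$|f(x)-\phi(x)|\le 19\,B_0\,(s+1)^2\,d^{\,s+\max\{\beta,1\}/2}\,(NM)^{-2\beta/d}.$$ -/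

import Mathlib

noncomputable section

/-- The closed unit cube `[0,1]^d` in Euclidean space. -/
def unitCube (d : ℕ) : Set (EuclideanSpace ℝ (Fin d)) :=
  {x | ∀ i, x i ∈ Set.Icc (0 : ℝ) 1}

/-- The `i`-th first order partial derivative `∂ᵢ g` of a function on `[0,1]^d`
(one-sided at the boundary faces `xᵢ = 0` and `xᵢ = 1`). It depends only on the values of `g`
on the cube. -/
def cubePartial {d : ℕ} (i : Fin d) (g : EuclideanSpace ℝ (Fin d) → ℝ) :
    EuclideanSpace ℝ (Fin d) → ℝ :=
  fun x => lineDerivWithin ℝ g (unitCube d) x (EuclideanSpace.single i (1 : ℝ))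

/-- The partial derivative `∂^α f = ∂₁^{α₁} ⋯ ∂_d^{α_d} f` on `[0,1]^d`. -/
def cubeDeriv {d : ℕ} (α : Fin d → ℕ) (f : EuclideanSpace ℝ (Fin d) → ℝ) :
    EuclideanSpace ℝ (Fin d) → ℝ :=
  (List.finRange d).foldr (fun i g => (cubePartial i)^[α i] g) f

/-- The Hölder class `ℋ^β([0,1]^d, B₀)` with `β = s + r`, `s ∈ ℕ`, `r ∈ (0,1]`: functions of
class `C^s` on `[0,1]^d` all of whose partial derivatives of order at most `s` are bounded by
`B₀`, those of order exactly `s` being `r`-Hölder for the Euclidean norm with constant `B₀`.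
Only the values on the cube matter. -/
def holderClass (d s : ℕ) (r B₀ : ℝ) : Set (EuclideanSpace ℝ (Fin d) → ℝ) :=
  {f | ContDiffOn ℝ s f (unitCube d) ∧
    (∀ α : Fin d → ℕ, ∑ i, α i ≤ s → ∀ x ∈ unitCube d, |cubeDeriv α f x| ≤ B₀) ∧
    (∀ α : Fin d → ℕ, ∑ i, α i = s → ∀ x ∈ unitCube d, ∀ y ∈ unitCube d,
      |cubeDeriv α f x - cubeDeriv α f y| ≤ B₀ * ‖x - y‖ ^ r)}

/-- Fully connected ReLU networks with `m` inputs and `n` outputs: either a single affine map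
`x ↦ A x + b` (no hidden layer), or a first hidden layer with `k` neurons computing
`σ(A x + b)`, followed by a network with `k` inputs. -/
inductive ReLUNet (n : ℕ) : ℕ → Type
  | affine {m : ℕ} (A : Matrix (Fin n) (Fin m) ℝ) (b : Fin n → ℝ) : ReLUNet n m
  | layer {m k : ℕ} (A : Matrix (Fin k) (Fin m) ℝ) (b : Fin k → ℝ) (rest : ReLUNet n k) :
      ReLUNet n m

namespace ReLUNet

/-- The function computed by a network; `σ(t) = max(0, t)` acts componentwise. -/
def eval {n : ℕ} : {m : ℕ} → ReLUNet n m → (Fin m → ℝ) → (Fin n → ℝ)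
  | _, affine A b, x => A.mulVec x + b
  | _, layer A b rest, x => rest.eval (fun j => max 0 ((A.mulVec x + b) j))

/-- The number of hidden layers. -/
def depth {n : ℕ} : {m : ℕ} → ReLUNet n m → ℕ
  | _, affine _ _ => 0
  | _, layer _ _ rest => rest.depth + 1

/-- The maximal number of neurons in a hidden layer. -/
def width {n : ℕ} : {m : ℕ} → ReLUNet n m → ℕ
  | _, affine _ _ => 0
  | _, layer (k := k) _ _ rest => max k rest.width

end ReLUNet

end

/-!
Cut the cube into `K ^ d ≈ (N M)²` cells and replace `f` on each cell by its Taylor polynomial of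
degree `s` at the lowest corner. A network of width about `N` finds the corner, and the offset in
the cell, by reading off the digits of the coordinates in base `2 N`, one digit per layer; powers of
the offset are computed exactly from its digits.

The derivatives at the corners form a table with at most `N · N · M · M` entries. Two indices are
decoded in unary across the width, the third is scanned along the depth, and the fourth selects a
bit block in the binary expansion of a single weight, from which bits are extracted layer by layer.
This is how `(N M)²` values are stored in a network of size about `N` by `M`.

Digits are discontinuous, so the network is only correct when no coordinate of the input is slightly
below a grid point. Of `t - η`, `t`, `t + η` at least two avoid this, so a median over the three
translates, taken in one coordinate after the other, is correct everywhere; each coordinate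
triples the width and adds two layers.
-/

namespace ReLUCalculus

/-! ### Functions computed by ReLU networks -/

variable {X Y : Type*}

section AffineSpan

/-- The affine combinations of a set of real functions: what an affine layer can produce from
them. -/
def affSpan (S : Set (X → ℝ)) : Submodule ℝ (X → ℝ) := Submodule.span ℝ (insert 1 S)

variable {S T : Set (X → ℝ)} {f g : X → ℝ}

lemma subset_affSpan : S ⊆ affSpan S :=
  (Set.subset_insert _ _).trans Submodule.subset_span

lemma mem_affSpan (h : f ∈ S) : f ∈ affSpan S := subset_affSpan h

lemma const_mem_affSpan (c : ℝ) : (fun _ => c : X → ℝ) ∈ affSpan S := by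
  have h : (fun _ => c : X → ℝ) = c • (1 : X → ℝ) := by ext; simp
  rw [h]
  exact Submodule.smul_mem _ _ (Submodule.subset_span (Set.mem_insert _ _))

lemma add_mem_affSpan (hf : f ∈ affSpan S) (hg : g ∈ affSpan S) :
    (fun x => f x + g x) ∈ affSpan S :=
  add_mem hf hg

lemma sub_mem_affSpan (hf : f ∈ affSpan S) (hg : g ∈ affSpan S) :
    (fun x => f x - g x) ∈ affSpan S :=
  sub_mem hf hg

lemma const_mul_mem_affSpan (c : ℝ) (hf : f ∈ affSpan S) : (fun x => c * f x) ∈ affSpan S :=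
  Submodule.smul_mem _ c hf

lemma sum_mem_affSpan {ι : Type*} (s : Finset ι) {F : ι → X → ℝ}
    (h : ∀ i ∈ s, F i ∈ affSpan S) : (fun x => ∑ i ∈ s, F i x) ∈ affSpan S := by
  simpa only [Finset.sum_fn] using sum_mem h

lemma affSpan_le (h : S ⊆ affSpan T) : affSpan S ≤ affSpan T :=
  Submodule.span_le.2 (Set.insert_subset (const_mem_affSpan 1) h)

lemma affSpan_mono (h : S ⊆ T) : affSpan S ≤ affSpan T := affSpan_le (h.trans subset_affSpan)

lemma exists_eq_sum_add_const_of_mem_affSpan_range {ι : Type*} [Fintype ι] {e : ι → X → ℝ}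
    (h : f ∈ affSpan (Set.range e)) : ∃ (a : ι → ℝ) (c : ℝ), ∀ x, f x = ∑ i, a i * e i x + c := by
  obtain ⟨c, z, hz, rfl⟩ := Submodule.mem_span_insert.1 h
  obtain ⟨a, rfl⟩ := (Submodule.mem_span_range_iff_exists_fun ℝ).1 hz
  exact ⟨a, c, fun x => by simp [add_comm]⟩

lemma map_funLeft_affSpan (π : Y → X) (S : Set (X → ℝ)) :
    (affSpan S).map (LinearMap.funLeft ℝ ℝ π) = affSpan ((· ∘ π) '' S) := by
  rw [affSpan, affSpan, Submodule.map_span, Set.image_insert_eq]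
  rfl

lemma comp_mem_affSpan (π : Y → X) (hf : f ∈ affSpan S) : f ∘ π ∈ affSpan ((· ∘ π) '' S) :=
  map_funLeft_affSpan π S ▸ Submodule.mem_map_of_mem hf

lemma exists_comp_eq_of_mem_affSpan {π : Y → X} {B : Set (Y → ℝ)} (hB : B ⊆ (· ∘ π) '' S)
    {h : Y → ℝ} (hh : h ∈ affSpan B) : ∃ h' ∈ affSpan S, h' ∘ π = h :=
  (affSpan_mono hB).trans_eq (map_funLeft_affSpan π S).symm hh

end AffineSpan

section Encard

variable {α : Type*} {s t : Set α} {a b c : ℕ}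

lemma encard_union_le_of_le (hs : s.encard ≤ a) (ht : t.encard ≤ b) (h : a + b ≤ c) :
    (s ∪ t).encard ≤ c :=
  (Set.encard_union_le s t).trans ((add_le_add hs ht).trans (mod_cast h))

lemma encard_range_le {ι : Type*} [Fintype ι] (f : ι → α) (h : Fintype.card ι ≤ c) :
    (Set.range f).encard ≤ c := by
  rw [← Set.image_univ]
  refine (Set.encard_image_le _ _).trans ?_
  rw [Set.encard_univ, ENat.card_eq_coe_fintype_card]
  exact_mod_cast h

lemma encard_singleton_le (x : α) : ({x} : Set α).encard ≤ (1 : ℕ) := by simp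

lemma encard_insert_le_of_le (x : α) (hs : s.encard ≤ a) : (insert x s).encard ≤ (a + 1 : ℕ) :=
  (Set.encard_insert_le s x).trans (mod_cast add_le_add_left hs 1)

lemma encard_pair_le (x y : α) : ({x, y} : Set α).encard ≤ (2 : ℕ) :=
  encard_insert_le_of_le x (encard_singleton_le y)

lemma encard_triple_le (x y z : α) : ({x, y, z} : Set α).encard ≤ (3 : ℕ) :=
  encard_insert_le_of_le x (encard_pair_le y z)

end Encard

/-- The composition of a real function with the activation `σ(t) = max(0, t)`. -/
def relu (g : X → ℝ) : X → ℝ := fun x => max 0 (g x)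

lemma relu_eq_self {g : X → ℝ} (h : ∀ x, 0 ≤ g x) : relu g = g :=
  funext fun x => max_eq_right (h x)

/-- `Computes S W D T`: all functions in `T` can be computed from those in `S` by a ReLU network
with `D` hidden layers of at most `W` neurons each. The functions live on an arbitrary domain `X`,
so that a network may be analysed on the subset of inputs on which it behaves well. -/
inductive Computes (S : Set (X → ℝ)) (W : ℕ) : ℕ → Set (X → ℝ) → Prop
  | affine {T : Set (X → ℝ)} (h : T ⊆ affSpan S) : Computes S W 0 T
  | step {D : ℕ} {T U V : Set (X → ℝ)} (h : Computes S W D T) (hU : U.encard ≤ W)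
      (hTU : ∀ g ∈ U, ∃ h ∈ affSpan T, g = relu h) (hUV : V ⊆ affSpan U) :
      Computes S W (D + 1) V

namespace Computes

variable {S S' T T' U : Set (X → ℝ)} {W W' D D' : ℕ}

lemma refl : Computes S W 0 S := affine subset_affSpan

lemma affine_comp (h : Computes S W D T) (hU : U ⊆ affSpan T) : Computes S W D U := by
  cases h with
  | affine h => exact affine (hU.trans (affSpan_le h))
  | step h hV hTV hVT => exact step h hV hTV (hU.trans (affSpan_le hVT))

lemma comp_affine (h : Computes S W D T) (hS : S ⊆ affSpan S') : Computes S' W D T := by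
  induction h with
  | affine h => exact affine (h.trans (affSpan_le hS))
  | step _ hU hTU hUV ih => exact step ih hU hTU hUV

lemma anti (h : Computes S W D T) (hU : U ⊆ T) : Computes S W D U :=
  h.affine_comp (hU.trans subset_affSpan)

lemma mono (h : Computes S W D T) (hS : S ⊆ S') : Computes S' W D T :=
  h.comp_affine (hS.trans subset_affSpan)

lemma mono_width (h : Computes S W D T) (hW : W ≤ W') : Computes S W' D T := by
  induction h with
  | affine h => exact affine h
  | step _ hU hTU hUV ih => exact step ih (hU.trans (mod_cast hW)) hTU hUV

lemma comp (h : Computes S W D T) (h' : Computes T W D' U) : Computes S W (D + D') U := by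
  induction h' with
  | affine h' => exact h.affine_comp h'
  | step _ hU hTU hUV ih => exact step ih hU hTU hUV

lemma single_layer (hU : U.encard ≤ W) (hSU : ∀ g ∈ U, ∃ h ∈ affSpan S, g = relu h)
    (hUT : T ⊆ affSpan U) : Computes S W 1 T :=
  step refl hU hSU hUT

-- `σ` is the identity on nonnegative numbers.
lemma carry (hS : S.encard ≤ W) (h0 : ∀ g ∈ S, ∀ x, 0 ≤ g x) (D : ℕ) : Computes S W D S := by
  induction D with
  | zero => exact refl
  | succ D ih =>
    exact step ih hS (fun g hg => ⟨g, mem_affSpan hg, (relu_eq_self (h0 g hg)).symm⟩)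
      subset_affSpan

lemma carry_singleton {g : X → ℝ} (h0 : ∀ x, 0 ≤ g x) (D : ℕ) : Computes {g} 1 D {g} :=
  carry (encard_singleton_le g) (by rintro _ rfl; exact h0) D

lemma carry_pair {g₁ g₂ : X → ℝ} (h₁ : ∀ x, 0 ≤ g₁ x) (h₂ : ∀ x, 0 ≤ g₂ x) (D : ℕ) :
    Computes {g₁, g₂} 2 D {g₁, g₂} :=
  carry (encard_pair_le g₁ g₂) (by rintro _ (rfl | rfl) <;> assumption) D

lemma delay (h : Computes S W D T) (hT : T.encard ≤ W) (h0 : ∀ g ∈ T, ∀ x, 0 ≤ g x)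
    (hD : D ≤ D') : Computes S W D' T := by
  obtain ⟨k, rfl⟩ := Nat.exists_eq_add_of_le hD
  exact h.comp (carry hT h0 k)

lemma parallel (h : Computes S W D T) (h' : Computes S' W' D T') :
    Computes (S ∪ S') (W + W') D (T ∪ T') := by
  have hl {A B : Set (X → ℝ)} : affSpan A ≤ affSpan (A ∪ B) := affSpan_mono Set.subset_union_left
  have hr {A B : Set (X → ℝ)} : affSpan B ≤ affSpan (A ∪ B) := affSpan_mono Set.subset_union_right
  induction D generalizing T T' with
  | zero =>
    cases h with | affine h =>
    cases h' with | affine h' =>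
    exact affine (Set.union_subset (h.trans hl) (h'.trans hr))
  | succ D ih =>
    cases h with | step h hU hTU hUV =>
    cases h' with | step h' hU' hTU' hUV' =>
    refine step (ih h h') (encard_union_le_of_le hU hU' le_rfl) ?_
      (Set.union_subset (hUV.trans hl) (hUV'.trans hr))
    rintro g (hg | hg)
    · obtain ⟨k, hk, rfl⟩ := hTU g hg
      exact ⟨k, hl hk, rfl⟩
    · obtain ⟨k, hk, rfl⟩ := hTU' g hg
      exact ⟨k, hr hk, rfl⟩

lemma union (h : Computes S W D T) (h' : Computes S W' D T') :
    Computes S (W + W') D (T ∪ T') := by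
  simpa only [Set.union_self] using h.parallel h'

lemma biUnion {ι : Type*} (s : Finset ι) {T : ι → Set (X → ℝ)}
    (h : ∀ i ∈ s, Computes S W D (T i)) : Computes S (s.card * W) D (⋃ i ∈ s, T i) := by
  classical
  induction s using Finset.induction_on with
  | empty =>
    simpa using (carry (S := (∅ : Set (X → ℝ))) (W := 0) (by simp) (by simp) D).mono
      (Set.empty_subset S)
  | insert i s hi ih =>
    have hi' := h i (Finset.mem_insert_self i s)
    have hs := ih fun j hj => h j (Finset.mem_insert_of_mem hj)
    rw [Finset.card_insert_of_notMem hi, Finset.set_biUnion_insert, add_mul, one_mul, add_comm]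
    exact hi'.union hs

lemma iUnion {ι : Type*} [Fintype ι] {T : ι → Set (X → ℝ)} (h : ∀ i, Computes S W D (T i)) :
    Computes S (Fintype.card ι * W) D (⋃ i, T i) := by
  simpa using biUnion Finset.univ fun i _ => h i

lemma comap (π : Y → X) (h : Computes S W D T) :
    Computes ((· ∘ π) '' S) W D ((· ∘ π) '' T) := by
  induction h with
  | affine h =>
    refine affine ?_
    rintro _ ⟨g, hg, rfl⟩
    exact comp_mem_affSpan π (h hg)
  | @step D T U V _ hU hTU hUV ih =>
    refine step (U := (· ∘ π) '' U) ih ((Set.encard_image_le _ _).trans hU) ?_ ?_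
    · rintro _ ⟨g, hg, rfl⟩
      obtain ⟨k, hk, rfl⟩ := hTU g hg
      exact ⟨k ∘ π, comp_mem_affSpan π hk, rfl⟩
    · rintro _ ⟨g, hg, rfl⟩
      exact comp_mem_affSpan π (hUV hg)

lemma exists_lift (π : Y → X) {T : Set (Y → ℝ)} (h : Computes ((· ∘ π) '' S) W D T) :
    ∃ T' : Set (X → ℝ), Computes S W D T' ∧ T ⊆ (· ∘ π) '' T' := by
  induction h with
  | affine h =>
    exact ⟨affSpan S, affine le_rfl, fun t ht => exists_comp_eq_of_mem_affSpan le_rfl (h ht)⟩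
  | @step D T U V _ hU hTU hUV ih =>
    obtain ⟨T', hT', hTT'⟩ := ih
    have hlift : ∀ g ∈ U, ∃ k ∈ affSpan T', relu k ∘ π = g := by
      intro g hg
      obtain ⟨k, hk, rfl⟩ := hTU g hg
      obtain ⟨k', hk', rfl⟩ := exists_comp_eq_of_mem_affSpan hTT' hk
      exact ⟨k', hk', rfl⟩
    choose! k hkT hkU using hlift
    set U' : Set (X → ℝ) := (fun g => relu (k g)) '' U
    refine ⟨affSpan U', step (U := U') hT' ((Set.encard_image_le _ _).trans hU) ?_ le_rfl,
      fun t ht => exists_comp_eq_of_mem_affSpan ?_ (hUV ht)⟩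
    · rintro _ ⟨g, hg, rfl⟩
      exact ⟨k g, hkT g hg, rfl⟩
    · exact fun g hg => ⟨_, ⟨g, hg, rfl⟩, hkU g hg⟩

end Computes

open Computes

/-! ### Digits -/

section RobustFloor

/-- `k` is the integer part of `v`, and `v` stays at distance `δ` below the next integer. Networks
compute continuous functions, so they can only recover integer parts under such a gap. -/
def IsRobustFloor (δ v : ℝ) (k : ℕ) : Prop := (k : ℝ) ≤ v ∧ v ≤ k + 1 - δ

variable {δ v : ℝ} {k T : ℕ}

lemma isRobustFloor_natCast (k : ℕ) : IsRobustFloor 1 k k := ⟨le_rfl, by simp⟩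

lemma natCast_eq_mul_div_add_mod (k T : ℕ) : (k : ℝ) = T * (k / T : ℕ) + (k % T : ℕ) :=
  mod_cast (Nat.div_add_mod k T).symm

lemma IsRobustFloor.div (h : IsRobustFloor δ (T * v) k) (hT : 0 < T) :
    IsRobustFloor (δ / T) v (k / T) := by
  have hk := natCast_eq_mul_div_add_mod k T
  have hmod : ((k % T : ℕ) : ℝ) + 1 ≤ T := mod_cast Nat.mod_lt k hT
  have hT' : (0 : ℝ) < T := mod_cast hT
  obtain ⟨hlow, hup⟩ := h
  constructor <;> refine le_of_mul_le_mul_left ?_ hT'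
  · linarith
  · have : (T : ℝ) * ((k / T : ℕ) + 1 - δ / T) = T * (k / T : ℕ) + T - δ := by field_simp
    linarith

lemma IsRobustFloor.mod (h : IsRobustFloor δ (T * v) k) :
    IsRobustFloor δ (T * (v - (k / T : ℕ))) (k % T) := by
  have hk := natCast_eq_mul_div_add_mod k T
  obtain ⟨hlow, hup⟩ := h
  constructor <;> linarith

lemma IsRobustFloor.relu_sub_relu_eq_ite (hδ : 0 < δ) (h : IsRobustFloor δ v k) (i : ℕ) :
    δ⁻¹ * (max 0 (v - i + δ) - max 0 (v - i)) = if i ≤ k then 1 else 0 := by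
  obtain ⟨hlow, hup⟩ := h
  split_ifs with hi
  · have : (i : ℝ) ≤ k := mod_cast hi
    rw [max_eq_right (by linarith), max_eq_right (by linarith)]
    field_simp
    ring
  · have : (k : ℝ) + 1 ≤ i := mod_cast not_le.1 hi
    rw [max_eq_left (by linarith), max_eq_left (by linarith)]
    simp

end RobustFloor

section FunctionsOf

/-- All real functions of a natural-number valued quantity `a`. For bounded `a` this amounts to
knowing the indicators of the values of `a`, that is, to a unary encoding of `a`. -/
def functionsOf (a : X → ℕ) : Set (X → ℝ) := Set.range fun φ : ℕ → ℝ => φ ∘ a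

variable {a : X → ℕ} {A : ℕ} {S : Set (X → ℝ)}

lemma mem_functionsOf (a : X → ℕ) (φ : ℕ → ℝ) : (fun x => φ (a x)) ∈ functionsOf a := ⟨φ, rfl⟩

lemma functionsOf_subset_of_indicator (ha : ∀ x, a x < A)
    (h : ∀ i < A, (fun x => if a x = i then (1 : ℝ) else 0) ∈ affSpan S) :
    functionsOf a ⊆ affSpan S := by
  rintro _ ⟨φ, rfl⟩
  have hφ : φ ∘ a = fun x => ∑ i ∈ Finset.range A, φ i * (if a x = i then (1 : ℝ) else 0) := by
    ext x
    simp [ha x]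
  simp only [hφ]
  exact sum_mem_affSpan _ fun i hi => const_mul_mem_affSpan _ (h i (Finset.mem_range.1 hi))

lemma functionsOf_subset_of_threshold (ha : ∀ x, a x < A)
    (h : ∀ i < A, (fun x => if i ≤ a x then (1 : ℝ) else 0) ∈ affSpan S) :
    functionsOf a ⊆ affSpan S := by
  have hall : ∀ i, (fun x => if i ≤ a x then (1 : ℝ) else 0) ∈ affSpan S := by
    intro i
    by_cases hi : i < A
    · exact h i hi
    · have hzero : (fun x => if i ≤ a x then (1 : ℝ) else 0) = fun _ => 0 :=
        funext fun x => if_neg (by have := ha x; omega)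
      exact hzero ▸ const_mem_affSpan 0
  refine functionsOf_subset_of_indicator ha fun i _ => ?_
  have hdiff : (fun x => if a x = i then (1 : ℝ) else 0) = fun x =>
      (if i ≤ a x then (1 : ℝ) else 0) - (if i + 1 ≤ a x then (1 : ℝ) else 0) := by
    ext x
    split_ifs <;> first | omega | simp
  rw [hdiff]
  exact sub_mem_affSpan (hall _) (hall _)

lemma carry_functionsOf (ha : ∀ x, a x < A) (D : ℕ) :
    Computes (functionsOf a) A D (functionsOf a) := by
  set I : Set (X → ℝ) := Set.range fun (i : Fin A) x => if a x = i then (1 : ℝ) else 0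
  have hI : functionsOf a ⊆ affSpan I :=
    functionsOf_subset_of_indicator ha fun i hi => mem_affSpan ⟨⟨i, hi⟩, rfl⟩
  have hI' : I ⊆ functionsOf a := by
    rintro _ ⟨i, rfl⟩
    exact mem_functionsOf a fun n => if n = i then 1 else 0
  refine ((carry (encard_range_le _ (by simp)) ?_ D).mono hI').affine_comp hI
  rintro _ ⟨i, rfl⟩ x
  dsimp only
  split_ifs <;> norm_num

end FunctionsOf

section Digits

variable {u acc : X → ℝ} {k : X → ℕ} {R l T : ℕ} {δ : ℝ}

lemma computes_digit (hδ : 0 < δ) (hk : ∀ x, k x < R)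
    (hu : ∀ x, IsRobustFloor δ (R * u x) (k x)) :
    Computes {u} (2 * R + 1) 1 ({u} ∪ functionsOf k) := by
  set G₁ : Fin R → X → ℝ := fun i => relu fun x => R * u x - (i : ℕ) + δ
  set G₂ : Fin R → X → ℝ := fun i => relu fun x => R * u x - (i : ℕ)
  have hu_nonneg : ∀ x, 0 ≤ u x := fun x => nonneg_of_mul_nonneg_right
    ((Nat.cast_nonneg (k x)).trans (hu x).1) (mod_cast (Nat.zero_le _).trans_lt (hk x))
  have hu_mem : u ∈ affSpan ({u} : Set (X → ℝ)) := mem_affSpan rfl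
  refine single_layer (U := {u} ∪ (Set.range G₁ ∪ Set.range G₂)) (encard_union_le_of_le
    (encard_singleton_le _) (encard_union_le_of_le (encard_range_le _ (Fintype.card_fin R).le)
      (encard_range_le _ (Fintype.card_fin R).le) le_rfl) (by omega)) ?_ (Set.union_subset ?_ ?_)
  · rintro g (rfl | ⟨i, rfl⟩ | ⟨i, rfl⟩)
    · exact ⟨g, hu_mem, (relu_eq_self hu_nonneg).symm⟩
    · exact ⟨_, add_mem_affSpan (sub_mem_affSpan (const_mul_mem_affSpan _ hu_mem)
        (const_mem_affSpan _)) (const_mem_affSpan _), rfl⟩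
    · exact ⟨_, sub_mem_affSpan (const_mul_mem_affSpan _ hu_mem) (const_mem_affSpan _), rfl⟩
  · exact Set.subset_union_left.trans subset_affSpan
  · refine functionsOf_subset_of_threshold hk fun i hi => ?_
    have hthreshold : (fun x => if i ≤ k x then (1 : ℝ) else 0) =
        fun x => δ⁻¹ * (G₁ ⟨i, hi⟩ x - G₂ ⟨i, hi⟩ x) :=
      funext fun x => ((hu x).relu_sub_relu_eq_ite hδ i).symm
    rw [hthreshold]
    exact const_mul_mem_affSpan _ (sub_mem_affSpan (mem_affSpan (Or.inr (Or.inl ⟨_, rfl⟩)))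
      (mem_affSpan (Or.inr (Or.inr ⟨_, rfl⟩))))

lemma computes_shift_digit (hδ : 0 < δ) (hk : ∀ x, k x < R)
    (hu : ∀ x, IsRobustFloor δ (R * u x) (k x)) (hacc : ∀ x, 0 ≤ acc x) :
    Computes {u, acc} (2 * R + 2) 1 {fun x => R * u x - k x, fun x => R * acc x + k x} := by
  refine ((computes_digit hδ hk hu).parallel (carry_singleton hacc 1)).affine_comp ?_
  have hdigit : (fun x => (k x : ℝ)) ∈ affSpan ({u} ∪ functionsOf k ∪ {acc}) :=
    mem_affSpan (Or.inl (Or.inr (mem_functionsOf k (↑))))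
  rintro _ (rfl | rfl)
  · exact sub_mem_affSpan (const_mul_mem_affSpan _ (mem_affSpan (by simp))) hdigit
  · exact add_mem_affSpan (const_mul_mem_affSpan _ (mem_affSpan (by simp))) hdigit

lemma computes_shift_digits (hR : 0 < R) (hδ : 0 < δ) (hk : ∀ x, k x < R ^ l)
    (hu : ∀ x, IsRobustFloor δ (R ^ l * u x) (k x)) (hacc : ∀ x, 0 ≤ acc x) :
    Computes {u, acc} (2 * R + 2) l
      {fun x => R ^ l * u x - k x, fun x => R ^ l * acc x + k x} := by
  induction l generalizing u acc k with
  | zero =>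
    have hk0 : ∀ x, k x = 0 := fun x => by simpa using hk x
    simpa only [hk0, pow_zero, one_mul, Nat.cast_zero, sub_zero, add_zero] using refl
  | succ l ih =>
    have hT : 0 < R ^ l := pow_pos hR l
    have hfloor : ∀ x, IsRobustFloor δ ((R ^ l : ℕ) * (R * u x)) (k x) := fun x => by
      simpa only [Nat.cast_pow, ← mul_assoc, ← pow_succ] using hu x
    have hhead := computes_shift_digit (k := fun x => k x / R ^ l) (by positivity)
      (fun x => Nat.div_lt_of_lt_mul (pow_succ R l ▸ hk x)) (fun x => (hfloor x).div hT) hacc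
    have htail := ih (u := fun x => R * u x - (k x / R ^ l : ℕ))
      (acc := fun x => R * acc x + (k x / R ^ l : ℕ)) (fun x => Nat.mod_lt (k x) hT)
      (fun x => by simpa using (hfloor x).mod) (fun x => by have := hacc x; positivity)
    have hdigits : ∀ x, (k x : ℝ) = R ^ l * (k x / R ^ l : ℕ) + (k x % R ^ l : ℕ) := fun x =>
      mod_cast natCast_eq_mul_div_add_mod (k x) (R ^ l)
    convert add_comm l 1 ▸ hhead.comp htail using 2
    · ext x
      linear_combination -hdigits x
    · congr 1
      ext x
      linear_combination hdigits x

lemma computes_fract_floor (hR : 0 < R) (hδ : 0 < δ) (hk : ∀ x, k x < R ^ l)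
    (hu : ∀ x, IsRobustFloor δ (R ^ l * u x) (k x)) :
    Computes {u} (2 * R + 2) l {fun x => R ^ l * u x - k x, fun x => (k x : ℝ)} := by
  have h := (computes_shift_digits (acc := fun _ => 0) hR hδ hk hu fun _ => le_rfl).comp_affine
    (S' := {u}) (by
      rintro _ (rfl | rfl)
      · exact mem_affSpan rfl
      · exact const_mem_affSpan 0)
  simpa only [mul_zero, zero_add] using h

lemma mod_mem_affSpan {S : Set (X → ℝ)} (hk : (fun x => (k x : ℝ)) ∈ affSpan S)
    (hdiv : (fun x => ((k x / T : ℕ) : ℝ)) ∈ affSpan S) :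
    (fun x => ((k x % T : ℕ) : ℝ)) ∈ affSpan S := by
  have hmod : (fun x => ((k x % T : ℕ) : ℝ)) = fun x => (k x : ℝ) - T * (k x / T : ℕ) :=
    funext fun x => eq_sub_of_add_eq' (natCast_eq_mul_div_add_mod (k x) T).symm
  rw [hmod]
  exact sub_mem_affSpan hk (const_mul_mem_affSpan _ hdiv)

lemma isRobustFloor_mul_inv_mul_div {A T : ℕ} (hA : 0 < A) (hT : 0 < T) (k : ℕ) :
    IsRobustFloor (1 / T) (A * (((A : ℝ) * T)⁻¹ * k)) (k / T) := by
  refine IsRobustFloor.div ?_ hT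
  have hA' : (A : ℝ) ≠ 0 := mod_cast hA.ne'
  have hT' : (T : ℝ) ≠ 0 := mod_cast hT.ne'
  convert isRobustFloor_natCast k using 1
  field_simp

lemma computes_div_mod_unary {A : ℕ} (hA : 0 < A) (hT : 0 < T) (hk : ∀ x, k x < A * T) :
    Computes {fun x => (k x : ℝ)} (2 * A + 1) 1
      (functionsOf (fun x => k x / T) ∪ {fun x => ((k x % T : ℕ) : ℝ)}) := by
  have hdigit := computes_digit (u := fun x => ((A : ℝ) * T)⁻¹ * k x) (by positivity)
    (fun x => (Nat.div_lt_iff_lt_mul hT).2 (hk x))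
    fun x => isRobustFloor_mul_inv_mul_div hA hT (k x)
  refine (hdigit.comp_affine ?_).affine_comp (Set.union_subset ?_ ?_)
  · rintro _ rfl
    exact const_mul_mem_affSpan _ (mem_affSpan rfl)
  · exact Set.subset_union_right.trans subset_affSpan
  · rintro _ rfl
    refine mod_mem_affSpan ?_ (mem_affSpan (Or.inr (mem_functionsOf (fun x => k x / T) (↑))))
    have hk_eq : (fun x => (k x : ℝ)) = fun x => (A * T : ℝ) * (((A : ℝ) * T)⁻¹ * k x) := by
      ext x
      have hA' : (A : ℝ) ≠ 0 := mod_cast hA.ne'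
      have hT' : (T : ℝ) ≠ 0 := mod_cast hT.ne'
      field_simp
    rw [hk_eq]
    exact const_mul_mem_affSpan _ (mem_affSpan (by simp))

lemma computes_div_mod (hR : 0 < R) (hT : 0 < T) (hk : ∀ x, k x < R ^ l * T) :
    Computes {fun x => (k x : ℝ)} (2 * R + 2) l
      {fun x => ((k x / T : ℕ) : ℝ), fun x => ((k x % T : ℕ) : ℝ)} := by
  have hfloor := computes_fract_floor (δ := 1 / T) (u := fun x => ((R ^ l : ℕ) * T : ℝ)⁻¹ * k x) hR
    (by positivity) (fun x => (Nat.div_lt_iff_lt_mul hT).2 (hk x))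
    fun x => by simpa using isRobustFloor_mul_inv_mul_div (pow_pos hR l) hT (k x)
  refine (hfloor.comp_affine ?_).affine_comp ?_
  · rintro _ rfl
    exact const_mul_mem_affSpan _ (mem_affSpan rfl)
  · rintro _ (rfl | rfl)
    · exact mem_affSpan (by simp)
    · have hmod : (fun x => ((k x % T : ℕ) : ℝ)) =
          fun x => T * (R ^ l * (((R ^ l : ℕ) * T : ℝ)⁻¹ * k x) - (k x / T : ℕ)) := by
        ext x
        have hRl : (R : ℝ) ^ l ≠ 0 := mod_cast (pow_pos hR l).ne'
        have hT' : (T : ℝ) ≠ 0 := mod_cast hT.ne'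
        rw [natCast_eq_mul_div_add_mod (k x) T]
        push_cast
        field_simp
        ring
      rw [hmod]
      exact const_mul_mem_affSpan _ (mem_affSpan (by simp))

end Digits

section Gates

lemma max_zero_add_ite_sub_one {z : ℝ} (hz : z ∈ Set.Icc (0 : ℝ) 1) (p : Prop) [Decidable p] :
    max 0 (z + (if p then 1 else 0) - 1) = if p then z else 0 := by
  split_ifs
  · rw [max_eq_right] <;> linarith [hz.1]
  · rw [max_eq_left]
    linarith [hz.2]

lemma max_zero_add_ite_add_ite_sub_two {z : ℝ} (hz : z ∈ Set.Icc (0 : ℝ) 1) (p q : Prop)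
    [Decidable p] [Decidable q] :
    max 0 (z + (if p then 1 else 0) + (if q then 1 else 0) - 2) = if p ∧ q then z else 0 := by
  split_ifs
  all_goals first
    | tauto
    | rw [max_eq_right (by linarith [hz.1])]; ring
    | exact max_eq_left (by linarith [hz.2])

lemma computes_indicator (v : X → ℕ) (t : ℕ) :
    Computes {fun x => (v x : ℝ)} 3 1 {fun x => if v x = t then (1 : ℝ) else 0} := by
  set G : ℝ → X → ℝ := fun c => relu fun x => (v x : ℝ) - c
  refine single_layer (U := {G (t - 1), G t, G (t + 1)}) (encard_triple_le _ _ _) ?_ ?_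
  · have hG : ∀ c, ∃ h ∈ affSpan {fun x => (v x : ℝ)}, G c = relu h := fun c =>
      ⟨_, sub_mem_affSpan (mem_affSpan rfl) (const_mem_affSpan c), rfl⟩
    rintro _ (rfl | rfl | rfl) <;> exact hG _
  · rintro _ rfl
    -- The indicator of `t` on the integers is the hat function with nodes `t - 1`, `t`, `t + 1`.
    have hhat : (fun x => if v x = t then (1 : ℝ) else 0) =
        fun x => G (t - 1) x - 2 * G t x + G (t + 1) x := by
      ext x
      simp only [G, relu]
      rcases lt_trichotomy (v x) t with h | h | h
      · have : (v x : ℝ) + 1 ≤ t := mod_cast h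
        rw [if_neg h.ne, max_eq_left, max_eq_left, max_eq_left] <;> linarith
      · rw [if_pos h, h, max_eq_right, max_eq_left, max_eq_left] <;> linarith
      · have : (t : ℝ) + 1 ≤ v x := mod_cast h
        rw [if_neg h.ne', max_eq_right, max_eq_right, max_eq_right] <;> linarith
    rw [hhat]
    exact add_mem_affSpan (sub_mem_affSpan (mem_affSpan (by simp))
      (const_mul_mem_affSpan _ (mem_affSpan (by simp)))) (mem_affSpan (by simp))

end Gates

section Multiplication

variable {u z acc : X → ℝ} {k : X → ℕ} {R L : ℕ} {δ : ℝ}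

lemma sum_fin_ite_succ_le {R k : ℕ} (hk : k ≤ R) (z : ℝ) :
    ∑ i : Fin R, (if (i : ℕ) + 1 ≤ k then z else 0) = z * k := by
  rw [Fin.sum_univ_eq_sum_range fun i => if i + 1 ≤ k then z else 0, ← Finset.sum_filter]
  have hfilter : (Finset.range R).filter (fun i => i + 1 ≤ k) = Finset.range k := by
    ext i
    simp only [Finset.mem_filter, Finset.mem_range]
    omega
  rw [hfilter]
  simp [mul_comm]

-- With `k` in unary, `z * k` is a sum of the gated copies `σ(z + [i < k] - 1) = [i < k] z`.
lemma computes_digit_mul (hδ : 0 < δ) (hz : ∀ x, z x ∈ Set.Icc (0 : ℝ) 1)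
    (hacc : ∀ x, 0 ≤ acc x) (hk : ∀ x, k x < R)
    (hu : ∀ x, IsRobustFloor δ (R * u x) (k x)) :
    Computes {u, z, acc} (2 * R + 3) 2
      {fun x => R * u x - k x, fun x => (R : ℝ)⁻¹ * z x,
        fun x => acc x + (R : ℝ)⁻¹ * (z x * k x)} := by
  have hz0 : ∀ x, 0 ≤ z x := fun x => (hz x).1
  have hdigit := (computes_digit hδ hk hu).parallel (carry_pair hz0 hacc 1)
  rw [Set.singleton_union] at hdigit
  refine hdigit.comp (D' := 1) ?_
  set S : Set (X → ℝ) := {u} ∪ functionsOf k ∪ {z, acc}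
  have hdigit_mem (φ : ℕ → ℝ) : (fun x => φ (k x)) ∈ affSpan S :=
    mem_affSpan (Or.inl (Or.inr (mem_functionsOf k φ)))
  set u' : X → ℝ := fun x => R * u x - k x
  set G : Fin R → X → ℝ := fun i => relu fun x => z x + (if (i : ℕ) + 1 ≤ k x then 1 else 0) - 1
  have hG : ∀ x, z x * k x = ∑ i, G i x := fun x => by
    simp only [G, relu, max_zero_add_ite_sub_one (hz x), sum_fin_ite_succ_le (hk x).le]
  refine single_layer (U := Set.range G ∪ {u', z, acc}) (encard_union_le_of_le
    (encard_range_le _ (Fintype.card_fin R).le) (encard_triple_le _ _ _) (by omega)) ?_ ?_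
  · rintro g (⟨i, rfl⟩ | rfl | rfl | rfl)
    · exact ⟨_, sub_mem_affSpan (add_mem_affSpan (mem_affSpan (by simp [S]))
        (hdigit_mem fun n => if (i : ℕ) + 1 ≤ n then 1 else 0)) (const_mem_affSpan _), rfl⟩
    · exact ⟨_, sub_mem_affSpan (const_mul_mem_affSpan _ (mem_affSpan (by simp [S])))
        (hdigit_mem (↑)), (relu_eq_self fun x => sub_nonneg.2 (hu x).1).symm⟩
    · exact ⟨_, mem_affSpan (by simp [S]), (relu_eq_self hz0).symm⟩
    · exact ⟨_, mem_affSpan (by simp [S]), (relu_eq_self hacc).symm⟩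
  · simp only [hG]
    rintro _ (rfl | rfl | rfl)
    · exact mem_affSpan (by simp)
    · exact const_mul_mem_affSpan _ (mem_affSpan (by simp))
    · exact add_mem_affSpan (mem_affSpan (by simp)) (const_mul_mem_affSpan _
        (sum_mem_affSpan _ fun i _ => mem_affSpan (by simp)))

lemma computes_add_mul_digits (hR : 0 < R) (hδ : 0 < δ) (hz : ∀ x, z x ∈ Set.Icc (0 : ℝ) 1)
    (hacc : ∀ x, 0 ≤ acc x) (hk : ∀ x, k x < R ^ L)
    (hu : ∀ x, IsRobustFloor δ (R ^ L * u x) (k x)) :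
    Computes {u, z, acc} (2 * R + 3) (2 * L) {fun x => acc x + z x * (k x / R ^ L)} := by
  induction L generalizing u z acc k with
  | zero =>
    have hk0 : ∀ x, k x = 0 := fun x => by simpa using hk x
    refine affine ?_
    rintro _ rfl
    simpa [hk0] using mem_affSpan (S := {u, z, acc}) (f := acc) (by simp)
  | succ L ih =>
    have hT : 0 < R ^ L := pow_pos hR L
    have hR' : (0 : ℝ) < R := mod_cast hR
    have hR1 : (1 : ℝ) ≤ R := mod_cast hR
    have hfloor : ∀ x, IsRobustFloor δ ((R ^ L : ℕ) * (R * u x)) (k x) := fun x => by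
      simpa only [Nat.cast_pow, ← mul_assoc, ← pow_succ] using hu x
    have hhead := computes_digit_mul (k := fun x => k x / R ^ L) (by positivity) hz hacc
      (fun x => Nat.div_lt_of_lt_mul (pow_succ R L ▸ hk x)) (fun x => (hfloor x).div hT)
    have htail := ih (u := fun x => R * u x - (k x / R ^ L : ℕ)) (z := fun x => (R : ℝ)⁻¹ * z x)
      (acc := fun x => acc x + (R : ℝ)⁻¹ * (z x * (k x / R ^ L : ℕ)))
      (fun x => ⟨by have := (hz x).1; positivity, by
        rw [inv_mul_le_iff₀ hR']
        linarith [(hz x).2]⟩)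
      (fun x => by have := (hz x).1; have := hacc x; positivity)
      (fun x => Nat.mod_lt (k x) hT) (fun x => by simpa using (hfloor x).mod)
    convert hhead.comp htail using 2
    · ring
    · ext x
      rw [natCast_eq_mul_div_add_mod (k x) (R ^ L)]
      push_cast
      field_simp
      ring

lemma computes_mul_digits (hR : 0 < R) (hδ : 0 < δ) (hz : ∀ x, z x ∈ Set.Icc (0 : ℝ) 1)
    (hk : ∀ x, k x < R ^ L) (hu : ∀ x, IsRobustFloor δ (R ^ L * u x) (k x)) :
    Computes {u, z} (2 * R + 3) (2 * L) {fun x => z x * (k x / R ^ L)} := by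
  have h := (computes_add_mul_digits (acc := fun _ => 0) hR hδ hz (fun _ => le_rfl) hk
    hu).comp_affine (S' := {u, z}) (by
      rintro _ (rfl | rfl | rfl)
      · exact mem_affSpan (by simp)
      · exact mem_affSpan (by simp)
      · exact const_mem_affSpan 0)
  simpa only [zero_add] using h

lemma computes_prod_digits {d n : ℕ} (hR : 0 < R) (hδ : 0 < δ) {u : Fin d → X → ℝ}
    {k : Fin d → X → ℕ} {F : X → ℝ} (hF : ∀ x, 0 ≤ F x) (hk : ∀ i x, k i x < R ^ L)
    (hu : ∀ i x, IsRobustFloor δ (R ^ L * u i x) (k i x)) (σ : Fin n → Fin d) :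
    Computes (Set.range u ∪ {F}) (2 * R + d + 4) (2 * L * n)
      (Set.range u ∪ {F} ∪ {fun x => ∏ i, ((k (σ i) x : ℝ) / R ^ L)}) := by
  have hRL : (0 : ℝ) < R ^ L := mod_cast pow_pos hR L
  have hu0 : ∀ i x, 0 ≤ u i x := fun i x =>
    nonneg_of_mul_nonneg_right ((Nat.cast_nonneg _).trans (hu i x).1) hRL
  have hfrac : ∀ i x, (k i x : ℝ) / R ^ L ∈ Set.Icc (0 : ℝ) 1 := fun i x =>
    ⟨by positivity, div_le_one_of_le₀ (mod_cast (hk i x).le) hRL.le⟩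
  induction n with
  | zero =>
    refine affine (Set.union_subset subset_affSpan ?_)
    rintro _ rfl
    simpa using const_mem_affSpan (S := Set.range u ∪ {F}) 1
  | succ n ih =>
    set z : X → ℝ := fun x => ∏ i : Fin n, ((k (σ i.castSucc) x : ℝ) / R ^ L)
    have hmul := computes_mul_digits (z := z) hR hδ (fun x => ⟨Finset.prod_nonneg fun i _ =>
        (hfrac _ x).1, Finset.prod_le_one (fun i _ => (hfrac _ x).1) fun i _ => (hfrac _ x).2⟩)
      (hk (σ (Fin.last n))) (hu _)
    have hcarry : Computes (Set.range u ∪ {F}) (d + 1) (2 * L) (Set.range u ∪ {F}) := by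
      refine carry (encard_union_le_of_le (encard_range_le _ (by simp))
        (encard_singleton_le _) le_rfl) ?_ _
      rintro _ (⟨i, rfl⟩ | rfl)
      · exact hu0 i
      · exact hF
    have hstep : Computes (Set.range u ∪ {F} ∪ {z}) (2 * R + d + 4) (2 * L)
        (Set.range u ∪ {F} ∪ {fun x => z x * (k (σ (Fin.last n)) x / R ^ L)}) := by
      refine ((hcarry.mono Set.subset_union_left).union (hmul.mono ?_)).mono_width (by omega)
      rintro _ (rfl | rfl) <;> simp
    rw [mul_add_one]
    simpa only [Fin.prod_univ_castSucc] using (ih fun i => σ i.castSucc).comp hstep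

end Multiplication

/-! ### Tables -/

section Lookup

variable {A : ℕ} {a b v : X → ℕ}

lemma computes_read {q : X → Prop} [DecidablePred q] {Y : ℕ → ℕ → ℝ} (hb : ∀ x, b x < A)
    (hY : ∀ i j, Y i j ∈ Set.Icc (0 : ℝ) 1) :
    Computes (functionsOf a ∪ functionsOf b ∪ {fun x => if q x then (1 : ℝ) else 0}) A 1
      {fun x => if q x then Y (a x) (b x) else 0} := by
  set G : Fin A → X → ℝ := fun i => relu fun x =>
    Y (a x) i + (if b x = i then (1 : ℝ) else 0) + (if q x then (1 : ℝ) else 0) - 2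
  refine single_layer (U := Set.range G) (encard_range_le _ (by simp)) ?_ ?_
  · rintro _ ⟨i, rfl⟩
    exact ⟨_, sub_mem_affSpan (add_mem_affSpan (add_mem_affSpan
      (mem_affSpan (Or.inl (Or.inl (mem_functionsOf a fun n => Y n i))))
      (mem_affSpan (Or.inl (Or.inr (mem_functionsOf b fun n => if n = i then 1 else 0)))))
      (mem_affSpan (Or.inr rfl))) (const_mem_affSpan _), rfl⟩
  · rintro _ rfl
    have hG : ∀ i x, G i x = if b x = i ∧ q x then Y (a x) i else 0 := fun i x =>
      max_zero_add_ite_add_ite_sub_two (hY _ _) _ _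
    have hsum : (fun x => if q x then Y (a x) (b x) else 0) = fun x => ∑ i, G i x := by
      ext x
      rw [Finset.sum_eq_single ⟨b x, hb x⟩ _ (by simp)]
      · simp [hG]
      · intro i _ hi
        rw [hG, if_neg fun h => hi (Fin.ext h.1.symm)]
    rw [hsum]
    exact sum_mem_affSpan _ fun i _ => mem_affSpan ⟨i, rfl⟩

lemma computes_lookup_step {acc : X → ℝ} {Y : ℕ → ℕ → ℝ} (ha : ∀ x, a x < A)
    (hb : ∀ x, b x < A) (hacc : ∀ x, 0 ≤ acc x) (hY : ∀ i j, Y i j ∈ Set.Icc (0 : ℝ) 1) (m : ℕ) :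
    Computes (functionsOf a ∪ functionsOf b ∪ {fun x => (v x : ℝ), acc}) (3 * A + 5) 2
      (functionsOf a ∪ functionsOf b ∪ {fun x => (v x : ℝ),
        fun x => acc x + if v x = m then Y (a x) (b x) else 0}) := by
  set S : Set (X → ℝ) := functionsOf a ∪ functionsOf b ∪ {fun x => (v x : ℝ), acc}
  set I : Set (X → ℝ) := {fun x => if v x = m then (1 : ℝ) else 0}
  have hcarry : Computes S (A + A + 2) 1 S :=
    ((carry_functionsOf ha 1).parallel (carry_functionsOf hb 1)).parallel
      (carry_pair (fun x => Nat.cast_nonneg (v x)) hacc 1)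
  have hindicator : Computes S (3 * A + 5) 1 (S ∪ I) :=
    (hcarry.union ((computes_indicator v m).mono (by simp [S]))).mono_width (by omega)
  have hread : Computes (S ∪ I) (3 * A + 5) 1
      (S ∪ {fun x => if v x = m then Y (a x) (b x) else 0}) :=
    ((hcarry.mono Set.subset_union_left).union ((computes_read hb hY).mono
      (Set.union_subset_union_left _ Set.subset_union_left))).mono_width (by omega)
  refine (hindicator.comp hread).affine_comp (Set.union_subset ?_ ?_)
  · exact (Set.subset_union_left.trans Set.subset_union_left).trans subset_affSpan
  · rintro _ (rfl | rfl)
    · exact mem_affSpan (by simp [S])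
    · exact add_mem_affSpan (mem_affSpan (by simp [S])) (mem_affSpan (by simp))

lemma ite_lt_succ_eq_add (m n : ℕ) (f : ℕ → ℝ) :
    (if n < m + 1 then f n else 0) = (if n < m then f n else 0) + if n = m then f m else 0 := by
  rcases lt_trichotomy n m with h | rfl | h
  · simp [h, h.ne, h.trans (Nat.lt_succ_self m)]
  · simp
  · rw [if_neg (by omega), if_neg (by omega), if_neg (by omega), add_zero]

-- Two of the three indices are given in unary and handled by width; the third one by depth.
lemma computes_lookup {Y : ℕ → ℕ → ℕ → ℝ} (ha : ∀ x, a x < A) (hb : ∀ x, b x < A)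
    (hY : ∀ i j k, Y i j k ∈ Set.Icc (0 : ℝ) 1) (B : ℕ) :
    Computes (functionsOf a ∪ functionsOf b ∪ {fun x => (v x : ℝ)}) (3 * A + 5) (2 * B)
      (functionsOf a ∪ functionsOf b ∪
        {fun x => (v x : ℝ), fun x => if v x < B then Y (v x) (a x) (b x) else 0}) := by
  induction B with
  | zero =>
    refine affine (Set.union_subset (Set.subset_union_left.trans subset_affSpan) ?_)
    rintro _ (rfl | rfl)
    · exact mem_affSpan (by simp)
    · simpa using const_mem_affSpan 0
  | succ B ih =>
    have hacc : ∀ x, 0 ≤ if v x < B then Y (v x) (a x) (b x) else 0 := fun x => by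
      split_ifs
      exacts [(hY _ _ _).1, le_rfl]
    have hsucc : (fun x => if v x < B + 1 then Y (v x) (a x) (b x) else 0) = _ :=
      funext fun x => ite_lt_succ_eq_add B (v x) fun n => Y n (a x) (b x)
    rw [hsucc]
    exact ih.comp (computes_lookup_step ha hb hacc (hY B) B)

end Lookup

section Bits

/-- The real number with binary expansion `0.b₀b₁…b_{T-1}`. -/
noncomputable def binaryValue (b : ℕ → ℕ) (T : ℕ) : ℝ :=
  ∑ t ∈ Finset.range T, (b t : ℝ) / 2 ^ (t + 1)

lemma binaryValue_nonneg (b : ℕ → ℕ) (T : ℕ) : 0 ≤ binaryValue b T :=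
  Finset.sum_nonneg fun _ _ => by positivity

lemma binaryValue_le {b : ℕ → ℕ} (hb : ∀ t, b t ≤ 1) (T : ℕ) :
    binaryValue b T ≤ 1 - 1 / 2 ^ T := by
  induction T with
  | zero => simp [binaryValue]
  | succ T ih =>
    have hlast : (b T : ℝ) / 2 ^ (T + 1) ≤ 1 / 2 ^ (T + 1) := by
      gcongr
      exact_mod_cast hb T
    have hhalf : (1 : ℝ) / 2 ^ T = 2 * (1 / 2 ^ (T + 1)) := by
      rw [pow_succ]
      field_simp
    rw [binaryValue, Finset.sum_range_succ, ← binaryValue]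
    linarith

lemma binaryValue_mem_Icc {b : ℕ → ℕ} (hb : ∀ t, b t ≤ 1) (T : ℕ) :
    binaryValue b T ∈ Set.Icc (0 : ℝ) 1 :=
  ⟨binaryValue_nonneg b T, (binaryValue_le hb T).trans (sub_le_self _ (by positivity))⟩

lemma binaryValue_add (b : ℕ → ℕ) (m n : ℕ) :
    binaryValue b (m + n) = binaryValue b m + (1 / 2) ^ m * binaryValue (fun t => b (m + t)) n := by
  simp only [binaryValue, Finset.sum_range_add, Finset.mul_sum]
  congr 1
  refine Finset.sum_congr rfl fun t _ => ?_
  rw [one_div_pow, add_assoc, pow_add]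
  field_simp

lemma binaryValue_mul (b : ℕ → ℕ) (n e : ℕ) :
    binaryValue b (n * e) =
      ∑ p ∈ Finset.range n, (1 / 2) ^ (p * e) * binaryValue (fun t => b (p * e + t)) e := by
  induction n with
  | zero => simp [binaryValue]
  | succ n ih => rw [Nat.succ_mul, binaryValue_add, ih, Finset.sum_range_succ]

lemma two_mul_binaryValue_succ (b : ℕ → ℕ) (T : ℕ) :
    2 * binaryValue b (T + 1) = b 0 + binaryValue (fun t => b (t + 1)) T := by
  rw [add_comm T, binaryValue_add]
  simp only [binaryValue, Finset.sum_range_one, add_comm 1]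
  ring

lemma isRobustFloor_two_mul_binaryValue {b : ℕ → ℕ} (hb : ∀ t, b t ≤ 1) (T : ℕ) :
    IsRobustFloor (1 / 2 ^ T) (2 * binaryValue b (T + 1)) (b 0) := by
  have hnonneg := binaryValue_nonneg (fun t => b (t + 1)) T
  have hle := binaryValue_le (fun t => hb (t + 1)) T
  rw [two_mul_binaryValue_succ]
  constructor <;> linarith

variable {b : ℕ → X → ℕ} {w : X → ℕ} {z acc : X → ℝ}

lemma computes_leading_bit (m T : ℕ) (hb : ∀ t x, b t x ≤ 1) (hz : ∀ x, 0 ≤ z x)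
    (hacc : ∀ x, 0 ≤ acc x) :
    Computes {fun x => binaryValue (b · x) (T + 1), fun x => (w x : ℝ), z, acc} 11 1
      ({fun x => binaryValue (b · x) (T + 1)} ∪ functionsOf (b 0) ∪
        ({fun x => if w x = m then (1 : ℝ) else 0} ∪ {fun x => (w x : ℝ), z, acc})) := by
  have hdigit : Computes {fun x => binaryValue (b · x) (T + 1)} 5 1 _ :=
    computes_digit (R := 2) (δ := 1 / 2 ^ T) (by positivity) (fun x => Nat.lt_succ_of_le (hb 0 x))
      fun x => mod_cast isRobustFloor_two_mul_binaryValue (fun t => hb t x) T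
  refine (hdigit.mono ?_).union (((computes_indicator w m).mono ?_).union
    ((carry (encard_triple_le (fun x => (w x : ℝ)) z acc) ?_ 1).mono ?_))
  · simp
  · simp
  · rintro _ (rfl | rfl | rfl)
    exacts [fun x => Nat.cast_nonneg _, hz, hacc]
  · exact Set.subset_insert _ _

lemma computes_next_bit (c : ℝ) (m T : ℕ) (hb : ∀ t x, b t x ≤ 1)
    (hz : ∀ x, z x ∈ Set.Icc (0 : ℝ) 1) (hacc : ∀ x, 0 ≤ acc x) :
    Computes {fun x => binaryValue (b · x) (T + 1), fun x => (w x : ℝ), z, acc} 11 2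
      {fun x => binaryValue (fun t => b (t + 1) x) T, fun x => (w x : ℝ), z,
        fun x => acc x + if w x = m then c * (b 0 x * z x) else 0} := by
  have hz0 : ∀ x, 0 ≤ z x := fun x => (hz x).1
  refine (computes_leading_bit m T hb hz0 hacc).comp (D' := 1) ?_
  set u : X → ℝ := fun x => binaryValue (b · x) (T + 1)
  set u' : X → ℝ := fun x => binaryValue (fun t => b (t + 1) x) T
  set wr : X → ℝ := fun x => (w x : ℝ)
  set I : X → ℝ := fun x => if w x = m then 1 else 0
  set S : Set (X → ℝ) := ({u} ∪ functionsOf (b 0)) ∪ ({I} ∪ {wr, z, acc})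
  have hbit (φ : ℕ → ℝ) : (fun x => φ (b 0 x)) ∈ affSpan S :=
    mem_affSpan (Or.inl (Or.inr (mem_functionsOf (b 0) φ)))
  set G : X → ℝ := relu fun x => z x + I x + (if b 0 x = 1 then 1 else 0) - 2
  have hG : ∀ x, (if w x = m then c * (b 0 x * z x) else 0) = c * G x := fun x => by
    have hGx : G x = _ := max_zero_add_ite_add_ite_sub_two (hz x) (w x = m) (b 0 x = 1)
    rcases Nat.le_one_iff_eq_zero_or_eq_one.1 (hb 0 x) with h | h <;> simp [hGx, h]
  refine single_layer (U := {G, u', wr, z, acc}) (encard_insert_le_of_le (a := 10) _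
    (encard_insert_le_of_le (a := 9) _ ((encard_triple_le _ _ _).trans (by norm_num)))) ?_ ?_
  · rintro _ (rfl | rfl | rfl | rfl | rfl)
    · exact ⟨_, sub_mem_affSpan (add_mem_affSpan (add_mem_affSpan (mem_affSpan (by simp [S]))
        (mem_affSpan (by simp [S]))) (hbit fun n => if n = 1 then 1 else 0))
        (const_mem_affSpan _), rfl⟩
    · have hu' : u' = fun x => 2 * u x - b 0 x :=
        funext fun x => eq_sub_of_add_eq' (two_mul_binaryValue_succ (b · x) T).symm
      refine ⟨u', ?_, (relu_eq_self fun x => binaryValue_nonneg _ T).symm⟩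
      rw [hu']
      exact sub_mem_affSpan (const_mul_mem_affSpan _ (mem_affSpan (by simp [S]))) (hbit (↑))
    · exact ⟨_, mem_affSpan (by simp [S, wr]), (relu_eq_self fun x => Nat.cast_nonneg _).symm⟩
    · exact ⟨_, mem_affSpan (by simp [S]), (relu_eq_self hz0).symm⟩
    · exact ⟨_, mem_affSpan (by simp [S]), (relu_eq_self hacc).symm⟩
  · simp only [hG]
    rintro _ (rfl | rfl | rfl | rfl)
    · exact mem_affSpan (by simp)
    · exact mem_affSpan (by simp)
    · exact mem_affSpan (by simp)
    · exact add_mem_affSpan (mem_affSpan (by simp))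
        (const_mul_mem_affSpan _ (mem_affSpan (by simp)))

lemma computes_sum_bits (T : ℕ) {c : ℕ → ℝ} (block : ℕ → ℕ) (hc : ∀ t, 0 ≤ c t)
    (hb : ∀ t x, b t x ≤ 1) (hz : ∀ x, z x ∈ Set.Icc (0 : ℝ) 1) (hacc : ∀ x, 0 ≤ acc x) :
    Computes {fun x => binaryValue (b · x) T, fun x => (w x : ℝ), z, acc} 11 (2 * T)
      {fun x => acc x + ∑ t ∈ Finset.range T,
        if w x = block t then c t * (b t x * z x) else 0} := by
  induction T generalizing b c block acc with
  | zero =>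
    refine affine ?_
    rintro _ rfl
    simpa using mem_affSpan (by simp)
  | succ T ih =>
    have hhead := computes_next_bit (w := w) (c 0) (block 0) T hb hz hacc
    have htail := ih (b := fun t => b (t + 1)) (c := fun t => c (t + 1)) (fun t => block (t + 1))
      (acc := fun x => acc x + if w x = block 0 then c 0 * (b 0 x * z x) else 0)
      (fun t => hc _) (fun t => hb _) fun x => add_nonneg (hacc x) (by
        have hc0 := hc 0
        have hz0 := (hz x).1
        positivity)
    convert hhead.comp htail using 2
    · ring
    · ext x
      rw [Finset.sum_range_succ']
      ring

end Bits

section TableEntry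

variable {A B R l n e : ℕ} {z : X → ℝ}

lemma sum_range_mul_ite_div {w : ℕ} (hw : w < B) (f : ℕ → ℝ) :
    ∑ t ∈ Finset.range (B * e), (if w = t / e then f (t % e) else 0) =
      ∑ t ∈ Finset.range e, f t := by
  rw [← Finset.sum_filter]
  refine Finset.sum_nbij' (· % e) (w * e + ·) (fun t ht => ?_) (fun t ht => ?_) (fun t ht => ?_)
    (fun t ht => ?_) fun _ _ => rfl
  · have hlt := Finset.mem_range.1 (Finset.mem_filter.1 ht).1
    exact Finset.mem_range.2 (Nat.mod_lt t (Nat.pos_of_ne_zero (by rintro rfl; simp at hlt)))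
  · have hlt := Finset.mem_range.1 ht
    refine Finset.mem_filter.2 ⟨Finset.mem_range.2 ?_, ?_⟩
    · calc w * e + t < w * e + e := by omega
        _ = (w + 1) * e := by ring
        _ ≤ B * e := Nat.mul_le_mul_right e hw
    · rw [mul_comm, Nat.mul_add_div (by omega), Nat.div_eq_of_lt hlt, add_zero]
  · rw [(Finset.mem_filter.1 ht).2]
    exact Nat.div_add_mod' t e
  · exact (Nat.mul_add_mod' w e t).trans (Nat.mod_eq_of_lt (Finset.mem_range.1 ht))

lemma exists_abs_sub_binaryValue_le {c : ℝ} (hc : c ∈ Set.Icc (0 : ℝ) 1) (T : ℕ) :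
    ∃ b : ℕ → ℕ, (∀ t, b t ≤ 1) ∧ |c - binaryValue b T| ≤ 1 / 2 ^ T := by
  induction T generalizing c with
  | zero => exact ⟨0, by simp, by simpa [binaryValue, abs_of_nonneg hc.1] using hc.2⟩
  | succ T ih =>
    obtain ⟨a, ha, hca⟩ : ∃ a : ℕ, a ≤ 1 ∧ 2 * c - a ∈ Set.Icc (0 : ℝ) 1 := by
      rcases le_total (1 / 2) c with h | h
      · exact ⟨1, le_rfl, by push_cast; constructor <;> linarith [hc.2]⟩
      · exact ⟨0, zero_le_one, by push_cast; constructor <;> linarith [hc.1]⟩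
    obtain ⟨b, hb, hcb⟩ := ih hca
    let b' : ℕ → ℕ := fun t => t.casesOn a b
    refine ⟨b', fun t => t.casesOn ha hb, ?_⟩
    have hbv : 2 * binaryValue b' (T + 1) = a + binaryValue b T := two_mul_binaryValue_succ b' T
    have hhalf : (1 : ℝ) / 2 ^ T = 2 * (1 / 2 ^ (T + 1)) := by
      rw [pow_succ]
      field_simp
    rw [abs_le] at hcb ⊢
    constructor <;> linarith

-- The digits below `A` are given in unary, since they will be resolved by width; those below `B` as
-- plain numbers, since they will be resolved by depth.
lemma exists_computes_mixed_radix_digits {j : X → ℕ} (hR : 0 < R) (hA : 0 < A) (hB : 0 < B)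
    (hBR : B ≤ R ^ l) (hj : ∀ x, j x < A * (A * B ^ 2)) :
    ∃ a b v w : X → ℕ, (∀ x, a x < A) ∧ (∀ x, b x < A) ∧ (∀ x, v x < B) ∧ (∀ x, w x < B) ∧
      (∀ x, j x = ((a x * A + b x) * B + v x) * B + w x) ∧
      Computes {fun x => (j x : ℝ)} (2 * R + 3 * A + 2) (2 + l)
        (functionsOf a ∪ functionsOf b ∪ {fun x => (v x : ℝ)} ∪ {fun x => (w x : ℝ)}) := by
  set T := A * B ^ 2 with hTdef
  have hT : 0 < T := by positivity
  have hB2 : 0 < B ^ 2 := by positivity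
  set a : X → ℕ := fun x => j x / T
  set k₁ : X → ℕ := fun x => j x % T
  set b : X → ℕ := fun x => k₁ x / B ^ 2
  set k₂ : X → ℕ := fun x => k₁ x % B ^ 2
  have ha : ∀ x, a x < A := fun x => (Nat.div_lt_iff_lt_mul hT).2 (hj x)
  have hk₁ : ∀ x, k₁ x < A * B ^ 2 := fun x => Nat.mod_lt _ hT
  have hb : ∀ x, b x < A := fun x => (Nat.div_lt_iff_lt_mul hB2).2 (hk₁ x)
  have hk₂ : ∀ x, k₂ x < B * B := fun x => (Nat.mod_lt _ hB2).trans_eq (sq B)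
  refine ⟨a, b, fun x => k₂ x / B, fun x => k₂ x % B, ha, hb,
    fun x => (Nat.div_lt_iff_lt_mul hB).2 (hk₂ x), fun x => Nat.mod_lt _ hB, fun x => ?_, ?_⟩
  · calc j x = T * a x + (B ^ 2 * b x + (B * (k₂ x / B) + k₂ x % B)) := by
          rw [Nat.div_add_mod, Nat.div_add_mod, Nat.div_add_mod]
      _ = _ := by rw [hTdef]; ring
  · have hcarry (D : ℕ) := carry_functionsOf ha D
    have hfirst : Computes {fun x => (j x : ℝ)} (2 * R + 3 * A + 2) 1
        (functionsOf a ∪ {fun x => (k₁ x : ℝ)}) :=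
      (computes_div_mod_unary hA hT hj).mono_width (by omega)
    have hsecond : Computes _ (2 * R + 3 * A + 2) 1 _ :=
      ((hcarry 1).parallel (computes_div_mod_unary hA hB2 hk₁)).mono_width (by omega)
    have hrest : Computes _ (2 * R + 3 * A + 2) l _ :=
      ((hcarry l).parallel ((carry_functionsOf hb l).parallel (computes_div_mod hR hB
        fun x => (hk₂ x).trans_le (Nat.mul_le_mul_right B hBR)))).mono_width (by omega)
    refine ((hfirst.comp hsecond).comp hrest).anti ?_
    rw [Set.union_assoc, Set.union_assoc, Set.singleton_union]

lemma computes_mul_entry_bits {a b v w : X → ℕ} {bit : ℕ → ℕ → ℕ → ℕ → ℕ → ℕ}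
    (ha : ∀ x, a x < A) (hb : ∀ x, b x < A) (hv : ∀ x, v x < B) (hw : ∀ x, w x < B)
    (hz : ∀ x, z x ∈ Set.Icc (0 : ℝ) 1) (hbit : ∀ i j k m t, bit i j k m t ≤ 1) :
    Computes (functionsOf a ∪ functionsOf b ∪ {fun x => (v x : ℝ)} ∪ {fun x => (w x : ℝ), z})
      (3 * A + 11) (2 * B + 2 * (B * e))
      {fun x => z x * binaryValue (bit (a x) (b x) (v x) (w x)) e} := by
  set β : ℕ → ℕ → ℕ → ℕ → ℕ := fun k i j t => bit i j k (t / e) (t % e)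
  have hβ : ∀ k i j t, β k i j t ≤ 1 := fun _ _ _ _ => hbit _ _ _ _ _
  have hlookup := ((computes_lookup (v := v) ha hb
    (fun k i j => binaryValue_mem_Icc (hβ k i j) (B * e)) B).parallel
    (carry_pair (fun x => Nat.cast_nonneg (w x)) (fun x => (hz x).1) _)).mono_width
    (show _ ≤ 3 * A + 11 by omega)
  have hsum := (computes_sum_bits (B * e) (b := fun t x => β (v x) (a x) (b x) t)
    (c := fun t => 1 / 2 ^ (t % e + 1)) (· / e) (fun t => by positivity) (fun t x => hβ _ _ _ t)
    hz (acc := fun _ => 0) (w := w) fun _ => le_rfl).mono_width (show 11 ≤ 3 * A + 11 by omega)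
  convert hlookup.comp (hsum.comp_affine ?_) using 2
  · ext x
    have hsel (t : ℕ) : (if w x = t / e then
        1 / 2 ^ (t % e + 1) * ((β (v x) (a x) (b x) t : ℝ) * z x) else 0) = if w x = t / e then
        z x * ((bit (a x) (b x) (v x) (w x) (t % e) : ℝ) / 2 ^ (t % e + 1)) else 0 := by
      split_ifs with h
      · rw [h]
        ring
      · rfl
    simp only [hsel, zero_add, binaryValue, Finset.mul_sum]
    exact (sum_range_mul_ite_div (hw x) fun t =>
      z x * ((bit (a x) (b x) (v x) (w x) t : ℝ) / 2 ^ (t + 1))).symm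
  · simp only [hv, if_true]
    rintro _ (rfl | rfl | rfl | rfl)
    · exact mem_affSpan (by simp)
    · exact mem_affSpan (by simp)
    · exact mem_affSpan (by simp)
    · exact const_mem_affSpan 0

lemma exists_computes_mul_table_entry {j : X → ℕ} {y : ℕ → ℝ} (hA : 0 < A) (hB : 0 < B)
    (hn : 0 < n) (hBl : B ≤ (2 * A) ^ l) (hj : ∀ x, j x < A * (A * B ^ 2))
    (hz : ∀ x, z x ∈ Set.Icc (0 : ℝ) 1) (hy : ∀ i, y i ∈ Set.Icc (0 : ℝ) 1) :
    ∃ v : X → ℝ, (∀ x, |y (j x) - v x| ≤ 1 / 2 ^ (n * e)) ∧ (∀ x, 0 ≤ v x) ∧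
      Computes {fun x => (j x : ℝ), z} (15 * n * A) (2 + l + (2 * B + 2 * (B * e)))
        {z, fun x => z x * v x} := by
  choose bit hbit hybit using fun i => exists_abs_sub_binaryValue_le (hy i) (n * e)
  refine ⟨fun x => binaryValue (bit (j x)) (n * e), fun x => hybit _,
    fun x => binaryValue_nonneg _ _, ?_⟩
  have hz0 : ∀ x, 0 ≤ z x := fun x => (hz x).1
  have hnA : n ≤ n * A := Nat.le_mul_of_pos_right n hA
  have hAn : A ≤ n * A := Nat.le_mul_of_pos_left A hn
  obtain ⟨a, b, v, w, ha, hb, hv, hw, hj', hdigits⟩ :=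
    exists_computes_mixed_radix_digits (R := 2 * A) (by positivity) hA hB hBl hj
  have hgroups := iUnion fun p : Fin n => computes_mul_entry_bits (e := e)
    (bit := fun i i' k m t => bit (((i * A + i') * B + k) * B + m) (p * e + t)) ha hb hv hw hz
    fun _ _ _ _ _ => hbit _ _
  rw [Fintype.card_fin] at hgroups
  have hread := (((hgroups.parallel (carry_singleton hz0 _))).mono_width
    (show _ ≤ 15 * n * A by nlinarith)).mono
    (S' := functionsOf a ∪ functionsOf b ∪ {fun x => (v x : ℝ)} ∪ {fun x => (w x : ℝ)} ∪ {z})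
    (by grind)
  refine (((hdigits.parallel (carry_singleton hz0 _)).mono_width
    (show _ ≤ 15 * n * A by nlinarith)).comp hread).affine_comp ?_
  rintro _ (rfl | rfl)
  · exact mem_affSpan (by simp)
  · have hsplit : (fun x => z x * binaryValue (bit (j x)) (n * e)) = fun x =>
        ∑ p : Fin n, (1 / 2) ^ (p * e) *
          (z x * binaryValue
            (fun t => bit (((a x * A + b x) * B + v x) * B + w x) (p * e + t)) e) := by
      ext x
      rw [binaryValue_mul, ← hj', Finset.mul_sum, ← Fin.sum_univ_eq_sum_range]
      exact Finset.sum_congr rfl fun p _ => mul_left_comm _ _ _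
    rw [hsplit]
    exact sum_mem_affSpan _ fun p _ => const_mul_mem_affSpan _
      (mem_affSpan (Or.inl (Set.mem_iUnion.2 ⟨p, rfl⟩)))

end TableEntry

section CellValue

/-- Truncation of a real number to `[0, c]`. -/
noncomputable def clamp (c t : ℝ) : ℝ := max 0 (min t c)

lemma clamp_eq_sub {c : ℝ} (hc : 0 ≤ c) (t : ℝ) : clamp c t = max 0 t - max 0 (t - c) := by
  rcases le_total t c with h | h
  · rw [clamp, min_eq_left h, max_eq_left (sub_nonpos.2 h), sub_zero]
  · rw [clamp, min_eq_right h, max_eq_right hc, max_eq_right (hc.trans h),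
      max_eq_right (sub_nonneg.2 h), sub_sub_cancel]

lemma computes_clamp {c : ℝ} (hc : 0 ≤ c) (x : X → ℝ) : Computes {x} 2 1 {clamp c ∘ x} := by
  refine single_layer (U := {relu x, relu fun q => x q - c}) (encard_pair_le _ _) ?_ ?_
  · rintro _ (rfl | rfl)
    · exact ⟨_, mem_affSpan rfl, rfl⟩
    · exact ⟨_, sub_mem_affSpan (mem_affSpan rfl) (const_mem_affSpan c), rfl⟩
  · rintro _ rfl
    have hclamp : clamp c ∘ x = fun q => relu x q - relu (fun q => x q - c) q :=
      funext fun q => clamp_eq_sub hc (x q)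
    rw [hclamp]
    exact sub_mem_affSpan (mem_affSpan (by simp)) (mem_affSpan (by simp))

variable {d A B R l L K n e k : ℕ} {c δ δ' : ℝ}

lemma computes_coordinate {x : X → ℝ} {m : X → ℕ} (hR : 0 < R) (hc : 0 ≤ c) (hδ : 0 < δ)
    (hK : K ≤ R ^ l) (hmK : ∀ q, m q < K) (hm : ∀ q, IsRobustFloor δ (K * clamp c (x q)) (m q)) :
    Computes {x} (2 * R + 2) (1 + l)
      {fun q => K * clamp c (x q) - m q, fun q => (m q : ℝ)} := by
  have hscale (q : X) : (R : ℝ) ^ l * (K / R ^ l * clamp c (x q)) = K * clamp c (x q) := by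
    have : (R : ℝ) ≠ 0 := mod_cast hR.ne'
    field_simp
  have hfloor := computes_fract_floor (u := fun q => K / R ^ l * clamp c (x q)) hR hδ
    (fun q => (hmK q).trans_le hK) fun q => (hscale q).symm ▸ hm q
  simp only [hscale] at hfloor
  refine ((computes_clamp hc x).mono_width (by omega)).comp (hfloor.comp_affine ?_)
  rintro _ rfl
  exact const_mul_mem_affSpan _ (mem_affSpan rfl)

variable {x : Fin d → X → ℝ} {m : X → Fin d → Fin K}

lemma computes_cell_index (hR : 0 < R) (hc : 0 ≤ c) (hδ : 0 < δ) (hK : K ≤ R ^ l)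
    (hm : ∀ i q, IsRobustFloor δ (K * clamp c (x i q)) (m q i)) :
    Computes (Set.range x) (d * (2 * R + 2)) (1 + l)
      (Set.range (fun i q => K * clamp c (x i q) - (m q i : ℕ)) ∪
        {fun q => ((finFunctionFinEquiv (m q) : ℕ) : ℝ)}) := by
  have hcoord := iUnion fun i => (computes_coordinate hR hc hδ hK (fun q => (m q i).2)
    (hm i)).mono (Set.singleton_subset_iff.2 (Set.mem_range_self i))
  rw [Fintype.card_fin] at hcoord
  refine hcoord.affine_comp (Set.union_subset ?_ ?_)
  · rintro _ ⟨i, rfl⟩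
    exact mem_affSpan (Set.mem_iUnion.2 ⟨i, by simp⟩)
  · rintro _ rfl
    have hindex : (fun q => ((finFunctionFinEquiv (m q) : ℕ) : ℝ)) =
        fun q => ∑ i : Fin d, (K : ℝ) ^ (i : ℕ) * (m q i : ℕ) := by
      ext q
      push_cast [finFunctionFinEquiv_apply]
      exact Finset.sum_congr rfl fun i _ => mul_comm _ _
    rw [hindex]
    exact sum_mem_affSpan _ fun i _ => const_mul_mem_affSpan _
      (mem_affSpan (Set.mem_iUnion.2 ⟨i, by simp⟩))

lemma exists_computes_mul_cell_value {p : Fin d → X → ℕ} {y : (Fin d → Fin K) → ℝ} (hd : 0 < d)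
    (hA : 0 < A) (hB : 0 < B) (hn : 0 < n) (hc : 0 ≤ c) (hδ : 0 < δ) (hδ' : 0 < δ')
    (hB' : B ≤ (2 * A) ^ l) (hK : K ≤ (2 * A) ^ l) (hKd : K ^ d ≤ A * (A * B ^ 2))
    (hy : ∀ i, y i ∈ Set.Icc (0 : ℝ) 1)
    (hm : ∀ i q, IsRobustFloor δ (K * clamp c (x i q)) (m q i))
    (hpL : ∀ i q, p i q < (2 * A) ^ L)
    (hp : ∀ i q, IsRobustFloor δ' ((2 * A : ℕ) ^ L * (K * clamp c (x i q) - (m q i : ℕ))) (p i q))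
    (σ : Fin k → Fin d) :
    ∃ v : X → ℝ, (∀ q, |y (m q) - v q| ≤ 1 / 2 ^ (n * e)) ∧ (∀ q, 0 ≤ v q) ∧
      Computes (Set.range x) (20 * d * A * n)
        (1 + l + 2 * L * k + (2 + l + (2 * B + 2 * (B * e))))
        {fun q => ∏ i, ((p (σ i) q : ℝ) / (2 * A : ℕ) ^ L),
          fun q => (∏ i, ((p (σ i) q : ℝ) / (2 * A : ℕ) ^ L)) * v q} := by
  have hR : 0 < 2 * A := by positivity
  have hone (i q) : (p i q : ℝ) / (2 * A : ℕ) ^ L ≤ 1 :=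
    div_le_one_of_le₀ (mod_cast (hpL i q).le) (by positivity)
  set j : X → ℕ := fun q => finFunctionFinEquiv (m q)
  set z : X → ℝ := fun q => ∏ i, ((p (σ i) q : ℝ) / (2 * A : ℕ) ^ L)
  have hz : ∀ q, z q ∈ Set.Icc (0 : ℝ) 1 := fun q =>
    ⟨Finset.prod_nonneg fun i _ => by positivity,
      Finset.prod_le_one (fun i _ => by positivity) fun i _ => hone _ q⟩
  obtain ⟨v, hyv, hv, hvalue⟩ := exists_computes_mul_table_entry (e := e) (j := j) (z := z)
    (y := fun j => if h : j < K ^ d then y (finFunctionFinEquiv.symm ⟨j, h⟩) else 0) hA hB hn hB'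
    (fun q => (finFunctionFinEquiv (m q)).2.trans_le hKd) hz fun i => by
      split_ifs
      exacts [hy _, ⟨le_rfl, zero_le_one⟩]
  have hdAn : d * A ≤ d * A * n := Nat.le_mul_of_pos_right _ hn
  have hAn : n * A ≤ d * (n * A) := Nat.le_mul_of_pos_left _ hd
  have hdA : d ≤ d * A := Nat.le_mul_of_pos_right _ hA
  have hAd : A ≤ d * A := Nat.le_mul_of_pos_left _ hd
  have hindex := (computes_cell_index hR hc hδ hK hm).mono_width
    (show _ ≤ 20 * d * A * n by nlinarith)
  have hprod := (computes_prod_digits (F := fun q => (j q : ℝ)) hR hδ' (fun q => by positivity)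
    hpL hp σ).mono_width (show _ ≤ 20 * d * A * n by nlinarith)
  refine ⟨v, fun q => ?_, hv, (hindex.comp hprod).comp
    ((hvalue.mono_width (by nlinarith)).mono ?_)⟩
  · simpa only [j, Fin.is_lt, dite_true, Fin.eta, Equiv.symm_apply_apply] using hyv q
  · rintro _ (rfl | rfl) <;> simp [z]

end CellValue

/-! ### Medians and removal of the exceptional set -/

section Median

/-- The median of three real numbers. -/
noncomputable def median (a b c : ℝ) : ℝ := max (min a b) (min (max a b) c)

/-- At least two of three propositions hold. -/
def AtLeastTwo (p q r : Prop) : Prop := p ∧ q ∨ q ∧ r ∨ p ∧ r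

lemma AtLeastTwo.imp {p q r p' q' r' : Prop} (h : AtLeastTwo p q r) (hp : p → p') (hq : q → q')
    (hr : r → r') : AtLeastTwo p' q' r' :=
  Or.imp (And.imp hp hq) (Or.imp (And.imp hq hr) (And.imp hp hr)) h

lemma median_mem_Icc {a b c l u : ℝ}
    (h : AtLeastTwo (a ∈ Set.Icc l u) (b ∈ Set.Icc l u) (c ∈ Set.Icc l u)) :
    median a b c ∈ Set.Icc l u := by
  simp only [AtLeastTwo, median, Set.mem_Icc, le_max_iff, le_min_iff, max_le_iff, min_le_iff] at *
  tauto

lemma max_eq_add_max_zero (s t : ℝ) : max s t = s + max 0 (t - s) := by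
  rw [← max_add_add_left, add_zero, add_sub_cancel]

lemma min_eq_sub_max_zero (s t : ℝ) : min s t = t - max 0 (t - s) := by
  linarith [min_add_max s t, max_eq_add_max_zero s t]

lemma median_eq (a b c : ℝ) :
    median a b c = max a b - max 0 (max a b - c) + max 0 (min a b - c) := by
  have hpq : min a b ≤ max a b := min_le_max
  rw [median]
  generalize min a b = p, max a b = q at *
  rcases le_total q c with hqc | hcq
  · rw [min_eq_left hqc, max_eq_right hpq, max_eq_left (by linarith), max_eq_left (by linarith)]
    ring
  · rw [min_eq_right hcq, max_eq_right (sub_nonneg.2 hcq), max_comm p, max_eq_add_max_zero]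
    ring

lemma mem_affSpan_of_relu {f : X → ℝ} {S : Set (X → ℝ)} (h : relu f ∈ S) (h' : relu (-f) ∈ S) :
    f ∈ affSpan S := by
  have hf : f = fun x => relu f x - relu (-f) x :=
    funext fun x => (max_zero_sub_max_neg_zero_eq_self (f x)).symm.trans
      (congrArg₂ _ (max_comm _ _) (max_comm _ _))
  rw [hf]
  exact sub_mem_affSpan (mem_affSpan h) (mem_affSpan h')

lemma computes_self (f : X → ℝ) : Computes {f} 2 1 {f} := by
  refine single_layer (U := {relu f, relu (-f)}) (encard_pair_le _ _) ?_ ?_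
  · rintro _ (rfl | rfl)
    exacts [⟨f, mem_affSpan rfl, rfl⟩, ⟨-f, neg_mem (mem_affSpan rfl), rfl⟩]
  · rintro _ rfl
    exact mem_affSpan_of_relu (by simp) (by simp)

lemma computes_max_min (f g : X → ℝ) :
    Computes {f, g} 5 1 {fun x => max (f x) (g x), fun x => min (f x) (g x)} := by
  have hdiff : Computes {f, g} 1 1 {relu fun x => g x - f x} := by
    refine single_layer (encard_singleton_le _) ?_ subset_affSpan
    rintro _ rfl
    exact ⟨_, sub_mem_affSpan (mem_affSpan (by simp)) (mem_affSpan (by simp)), rfl⟩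
  refine (((computes_self f).mono (by simp)).union
    (((computes_self g).mono (by simp)).union hdiff)).affine_comp ?_
  rintro _ (rfl | rfl)
  · rw [funext fun x => max_eq_add_max_zero (f x) (g x)]
    exact add_mem_affSpan (g := relu fun x => g x - f x) (mem_affSpan (by simp))
      (mem_affSpan (by simp))
  · rw [funext fun x => min_eq_sub_max_zero (f x) (g x)]
    exact sub_mem_affSpan (g := relu fun x => g x - f x) (mem_affSpan (by simp))
      (mem_affSpan (by simp))

lemma computes_median (f g h : X → ℝ) :
    Computes {f, g, h} 7 2 {fun x => median (f x) (g x) (h x)} := by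
  set q : X → ℝ := fun x => max (f x) (g x)
  set p : X → ℝ := fun x => min (f x) (g x)
  have hmax_min : Computes {f, g, h} 7 1 ({q, p} ∪ {h}) :=
    ((computes_max_min f g).parallel (computes_self h)).mono (by grind)
  have hrelu : Computes ({q, p} ∪ {h}) 2 1 {relu fun x => q x - h x, relu fun x => p x - h x} := by
    refine single_layer (encard_pair_le _ _) ?_ subset_affSpan
    rintro _ (rfl | rfl) <;>
      exact ⟨_, sub_mem_affSpan (mem_affSpan (by simp)) (mem_affSpan (by simp)), rfl⟩
  refine hmax_min.comp (((((computes_self q).mono (by simp)).union hrelu).affine_comp ?_).mono_width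
    (by norm_num))
  rintro _ rfl
  simp only [median_eq]
  exact add_mem_affSpan (g := relu fun x => p x - h x) (sub_mem_affSpan (f := q)
    (g := relu fun x => q x - h x) (mem_affSpan (by simp)) (mem_affSpan (by simp)))
    (mem_affSpan (by simp))

end Median

section CoordinateMedian

variable {d W D : ℕ} {g : (Fin d → ℝ) → ℝ} {η ε : ℝ} {G : Set ℝ}

/-- The coordinate functions on `ℝ^d`. -/
def coords (d : ℕ) : Set ((Fin d → ℝ) → ℝ) := Set.range fun i x => x i

/-- Translation of the `i`-th argument of `g` by `t`. -/
def shift (i : Fin d) (t : ℝ) (g : (Fin d → ℝ) → ℝ) : (Fin d → ℝ) → ℝ :=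
  fun x => g (Function.update x i (x i + t))

/-- The median of `g` and its two translates by `±η` in direction `i`. -/
noncomputable def coordMedian (i : Fin d) (η : ℝ) (g : (Fin d → ℝ) → ℝ) : (Fin d → ℝ) → ℝ :=
  fun x => median (shift i (-η) g x) (shift i 0 g x) (shift i η g x)

lemma computes_shift (hg : Computes (coords d) W D {g}) (i : Fin d) (t : ℝ) :
    Computes (coords d) W D {shift i t g} := by
  have hcomap := hg.comap fun x : Fin d → ℝ => Function.update x i (x i + t)
  rw [Set.image_singleton] at hcomap
  refine hcomap.comp_affine ?_
  rintro _ ⟨_, ⟨j, rfl⟩, rfl⟩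
  have hupdate : (fun x : Fin d → ℝ => Function.update x i (x i + t) j) =
      fun x => x j + if j = i then t else 0 := by
    ext x
    rcases eq_or_ne j i with rfl | hj <;> simp [*]
  change (fun x : Fin d → ℝ => Function.update x i (x i + t) j) ∈ _
  rw [hupdate]
  exact add_mem_affSpan (mem_affSpan ⟨j, rfl⟩) (const_mem_affSpan _)

lemma computes_coordMedian (hW : 3 ≤ W) (hg : Computes (coords d) W D {g}) (i : Fin d) (η : ℝ) :
    Computes (coords d) (3 * W) (D + 2) {coordMedian i η g} := by
  have hshifts : Computes (coords d) (3 * W) D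
      {shift i (-η) g, shift i 0 g, shift i η g} :=
    ((computes_shift hg i (-η)).union ((computes_shift hg i 0).union
      (computes_shift hg i η))).mono_width (by omega)
  exact hshifts.comp ((computes_median _ _ _).mono_width (by omega))

lemma abs_coordMedian_sub_le {i : Fin d} {x : Fin d → ℝ} {c : ℝ} (hη : 0 ≤ η)
    (hG : AtLeastTwo (x i - η ∈ G) (x i ∈ G) (x i + η ∈ G))
    (hg : ∀ t, |t| ≤ η → x i + t ∈ G → |shift i t g x - c| ≤ ε) :
    |coordMedian i η g x - c| ≤ ε := by
  simp only [abs_sub_comm _ c, Set.mem_Icc_iff_abs_le] at hg ⊢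
  refine median_mem_Icc (hG.imp (fun h => ?_) (fun h => ?_) fun h => ?_)
  · exact hg _ (by rw [abs_neg, abs_of_nonneg hη]) (sub_eq_add_neg (x i) η ▸ h)
  · exact hg _ (by rwa [abs_zero]) ((add_zero (x i)).symm ▸ h)
  · exact hg _ (abs_of_nonneg hη).le h

-- Taking medians coordinate by coordinate removes the exceptional set of an approximation.
lemma exists_computes_approx_of_approx_on_good {C : Set (Fin d → ℝ)} {F : (Fin d → ℝ) → ℝ}
    (hW : 3 ≤ W) (hg : Computes (coords d) W D {g}) (hη : 0 ≤ η)
    (hG : ∀ t, AtLeastTwo (t - η ∈ G) (t ∈ G) (t + η ∈ G))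
    (happrox : ∀ x ∈ C, ∀ y : Fin d → ℝ, (∀ i, |y i - x i| ≤ η ∧ y i ∈ G) → |g y - F x| ≤ ε) :
    ∃ φ : (Fin d → ℝ) → ℝ, Computes (coords d) (3 ^ d * W) (D + 2 * d) {φ} ∧
      ∀ x ∈ C, |φ x - F x| ≤ ε := by
  suffices H : ∀ s : Finset (Fin d), ∃ φ : (Fin d → ℝ) → ℝ,
      Computes (coords d) (3 ^ s.card * W) (D + 2 * s.card) {φ} ∧ ∀ x ∈ C, ∀ y : Fin d → ℝ,
        (∀ i ∈ s, y i = x i) → (∀ i ∉ s, |y i - x i| ≤ η ∧ y i ∈ G) → |φ y - F x| ≤ ε by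
    obtain ⟨φ, hφ, hφF⟩ := H Finset.univ
    rw [Finset.card_fin] at hφ
    exact ⟨φ, hφ, fun x hx => hφF x hx x (fun _ _ => rfl) fun i hi => absurd (Finset.mem_univ i) hi⟩
  intro s
  induction s using Finset.induction_on with
  | empty => exact ⟨g, by simpa using hg, fun x hx y _ hy => happrox x hx y fun i => hy i (by simp)⟩
  | insert i s hi ih =>
    obtain ⟨φ, hφ, hφF⟩ := ih
    refine ⟨coordMedian i η φ, ?_, fun x hx y hy_eq hy_good => ?_⟩
    · have hone : 1 ≤ 3 ^ s.card := Nat.one_le_pow _ _ (by norm_num)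
      rw [Finset.card_insert_of_notMem hi, pow_succ', mul_assoc]
      exact computes_coordMedian (by nlinarith) hφ i η
    · refine abs_coordMedian_sub_le hη (hG _) fun t ht htG => ?_
      refine hφF x hx _ (fun j hj => ?_) fun j hj => ?_
      · rw [Function.update_of_ne (ne_of_mem_of_not_mem hj hi)]
        exact hy_eq j (Finset.mem_insert_of_mem hj)
      · rcases eq_or_ne j i with rfl | hji
        · rw [Function.update_self]
          refine ⟨?_, htG⟩
          rwa [hy_eq j (Finset.mem_insert_self _ _), add_sub_cancel_left]
        · rw [Function.update_of_ne hji]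
          exact hy_good j (by simp [hji, hj])

end CoordinateMedian

section Networks

variable {n : ℕ}

lemma exists_net_comp_affine {k k' : ℕ} (ψ : ReLUNet n k) (A : Matrix (Fin k) (Fin k') ℝ)
    (b : Fin k → ℝ) : ∃ φ : ReLUNet n k', φ.depth = ψ.depth ∧ φ.width = ψ.width ∧
      ∀ x, φ.eval x = ψ.eval (A.mulVec x + b) := by
  cases ψ with
  | affine A' b' =>
    exact ⟨.affine (A' * A) (A'.mulVec b + b'), rfl, rfl, fun x => by
      simp [ReLUNet.eval, Matrix.mulVec_add, add_assoc]⟩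
  | layer A' b' rest =>
    exact ⟨.layer (A' * A) (A'.mulVec b + b') rest, rfl, rfl, fun x => by
      simp [ReLUNet.eval, Matrix.mulVec_add, add_assoc]⟩

lemma exists_net_of_mem_affSpan {k k' : ℕ} (ψ : ReLUNet n k) {e : Fin k → X → ℝ}
    {e' : Fin k' → X → ℝ} (h : ∀ i, e i ∈ affSpan (Set.range e')) :
    ∃ φ : ReLUNet n k', φ.depth = ψ.depth ∧ φ.width = ψ.width ∧
      ∀ x, φ.eval (fun i => e' i x) = ψ.eval (fun i => e i x) := by
  choose a c hac using fun i => exists_eq_sum_add_const_of_mem_affSpan_range (h i)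
  obtain ⟨φ, hdepth, hwidth, heval⟩ := exists_net_comp_affine ψ (Matrix.of a) c
  refine ⟨φ, hdepth, hwidth, fun x => ?_⟩
  rw [heval]
  congr 1
  ext i
  simp [Matrix.mulVec, dotProduct, hac i x]

lemma exists_enumeration {α : Type*} [Zero α] {U : Set α} {W : ℕ} (hU : U.encard ≤ W) :
    ∃ e : Fin W → α, U ⊆ Set.range e ∧ ∀ i, e i = 0 ∨ e i ∈ U := by
  have hfin : U.Finite := Set.finite_of_encard_le_coe hU
  have := hfin.fintype
  rw [Set.encard_eq_coe_toFinset_card, Set.toFinset_card] at hU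
  obtain ⟨ι⟩ : Nonempty (U ↪ Fin W) := Function.Embedding.nonempty_of_card_le (by
    rw [Fintype.card_fin]
    exact_mod_cast hU)
  refine ⟨Function.extend ι (↑) 0, fun u hu => ⟨ι ⟨u, hu⟩, ι.injective.extend_apply _ _ _⟩,
    fun i => ?_⟩
  rcases Set.range_extend_subset ι ((↑) : U → α) 0 ⟨i, rfl⟩ with ⟨u, hu⟩ | ⟨_, _, hi⟩
  · exact Or.inr (hu ▸ u.2)
  · exact Or.inl hi.symm

namespace Computes

-- The layers of width at most `W` are padded with zeros to width exactly `W`.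
lemma exists_net_comp {d W D : ℕ} {T : Set ((Fin d → ℝ) → ℝ)} (h : Computes (coords d) W D T) :
    ∀ {k : ℕ} (ψ : ReLUNet n k) {e : Fin k → (Fin d → ℝ) → ℝ}, (∀ i, e i ∈ affSpan T) →
      ∃ φ : ReLUNet n d, φ.depth = D + ψ.depth ∧
        φ.width = (if D = 0 then ψ.width else max W ψ.width) ∧
        ∀ x, φ.eval x = ψ.eval (fun i => e i x) := by
  induction h with
  | affine h =>
    intro k ψ e he
    obtain ⟨φ, hdepth, hwidth, heval⟩ := exists_net_of_mem_affSpan ψ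
      (e' := fun (i : Fin d) (x : Fin d → ℝ) => x i) fun i => affSpan_le h (he i)
    exact ⟨φ, by simpa using hdepth, by simpa using hwidth, heval⟩
  | step _ hU hTU hUV ih =>
    intro k ψ e he
    obtain ⟨e', hUe', he'U⟩ := exists_enumeration hU
    obtain ⟨ψ', hdepth, hwidth, heval⟩ := exists_net_of_mem_affSpan ψ (e' := e') fun i =>
      affSpan_mono hUe' (affSpan_le hUV (he i))
    choose p hpT hp using fun i => show ∃ p ∈ affSpan _, e' i = relu p from
      (he'U i).elim (fun h => ⟨0, zero_mem _, h.trans (relu_eq_self fun _ => le_rfl).symm⟩)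
        (hTU _)
    obtain ⟨φ, hdepth', hwidth', heval'⟩ := ih (.layer 1 0 ψ') hpT
    refine ⟨φ, ?_, ?_, fun x => ?_⟩
    · rw [hdepth', ReLUNet.depth, hdepth]
      ring
    · rw [hwidth', ReLUNet.width, hwidth]
      split_ifs <;> simp_all
    · rw [heval', ← heval]
      simp only [ReLUNet.eval, Matrix.one_mulVec, add_zero, hp, relu]

lemma exists_net {d W D : ℕ} {g : (Fin d → ℝ) → ℝ} (h : Computes (coords d) W D {g})
    (hD : D ≠ 0) : ∃ φ : ReLUNet 1 d, φ.width = W ∧ φ.depth = D ∧ ∀ x, φ.eval x 0 = g x := by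
  obtain ⟨φ, hdepth, hwidth, heval⟩ := h.exists_net_comp
    (.affine (1 : Matrix (Fin 1) (Fin 1) ℝ) 0) (e := fun _ : Fin 1 => g)
    fun _ => mem_affSpan rfl
  exact ⟨φ, by simpa [ReLUNet.width, hD] using hwidth, hdepth, fun x => by
    simp [heval, ReLUNet.eval]⟩

end Computes

end Networks

section GoodCells

/-- The reals whose multiple by `P`, once clamped to `[0, P - 1/4]`, has a robust integer part. -/
def cellGood (P : ℕ) : Set ℝ :=
  {t | ∃ k < P, IsRobustFloor (1 / 4) (P * clamp (1 - 1 / (4 * P)) t) k}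

variable {P k : ℕ} {x t : ℝ}

lemma mul_clamp (hP : 0 < P) (t : ℝ) :
    P * clamp (1 - 1 / (4 * P)) t = max 0 (min (P * t) (P - 1 / 4)) := by
  have hP' : (0 : ℝ) < P := mod_cast hP
  have hmul : (P : ℝ) * (1 - 1 / (4 * P)) = P - 1 / 4 := by field_simp
  rw [clamp, mul_max_of_nonneg _ _ hP'.le, mul_min_of_nonneg _ _ hP'.le, mul_zero, hmul]

lemma mem_cellGood_of_mem_Icc (hP : 0 < P) (z : ℤ) (ht : P * t ∈ Set.Icc (z : ℝ) (z + 3 / 4)) :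
    t ∈ cellGood P := by
  have hP1 : (1 : ℝ) ≤ P := mod_cast hP
  obtain ⟨hlow, hup⟩ := ht
  simp only [cellGood, Set.mem_ofPred_eq, mul_clamp hP, IsRobustFloor]
  rcases lt_or_ge z 0 with hz | hz
  · have hz' : (z : ℝ) ≤ -1 := mod_cast Int.le_sub_one_of_lt hz
    refine ⟨0, hP, ?_⟩
    rw [max_eq_left (min_le_iff.2 (Or.inl (by linarith)))]
    norm_num
  rcases le_or_gt (P : ℤ) z with hzP | hzP
  · have hzP' : (P : ℝ) ≤ z := mod_cast hzP
    refine ⟨P - 1, Nat.sub_lt hP one_pos, ?_⟩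
    rw [min_eq_right (by linarith), max_eq_right (by linarith), Nat.cast_pred hP]
    constructor <;> linarith
  · lift z to ℕ using hz
    have hzP' : (z : ℝ) + 1 ≤ P := mod_cast hzP
    rw [Int.cast_natCast] at hlow hup
    refine ⟨z, mod_cast hzP, ?_⟩
    rw [min_eq_left (by linarith), max_eq_right (z.cast_nonneg.trans hlow)]
    constructor <;> linarith

lemma atLeastTwo_mem_cellGood (hP : 0 < P) (t : ℝ) :
    AtLeastTwo (t - 1 / (4 * P) ∈ cellGood P) (t ∈ cellGood P) (t + 1 / (4 * P) ∈ cellGood P) := by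
  have : (0 : ℝ) < P := mod_cast hP
  have hleft : (P : ℝ) * (t - 1 / (4 * P)) = P * t - 1 / 4 := by field_simp
  have hright : (P : ℝ) * (t + 1 / (4 * P)) = P * t + 1 / 4 := by field_simp
  have hfloor := Int.floor_le (P * t)
  have hfloor' := Int.lt_floor_add_one (P * t)
  have hgood := fun {u : ℝ} => mem_cellGood_of_mem_Icc (t := u) hP
  set z := ⌊P * t⌋
  rcases le_or_gt (P * t) (z + 1 / 2) with hhalf | hhalf
  · refine Or.inr (Or.inl ⟨hgood z ?_, hgood z ?_⟩)
    · constructor <;> linarith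
    · rw [hright]; constructor <;> linarith
  rcases le_or_gt (P * t) (z + 3 / 4) with hquarter | hquarter
  · refine Or.inl ⟨hgood z ?_, hgood z ?_⟩
    · rw [hleft]; constructor <;> linarith
    · constructor <;> linarith
  · refine Or.inr (Or.inr ⟨hgood z ?_, hgood (z + 1) ?_⟩)
    · rw [hleft]; constructor <;> linarith
    · rw [hright]; push_cast; constructor <;> linarith

lemma abs_sub_div_le_of_isRobustFloor (hP : 0 < P) (hx : x ∈ Set.Icc (0 : ℝ) 1)
    (htx : |t - x| ≤ 1 / (4 * P))
    (hk : IsRobustFloor (1 / 4) (P * clamp (1 - 1 / (4 * P)) t) k) : |x - k / P| ≤ 2 / P := by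
  have hP' : (0 : ℝ) < P := mod_cast hP
  have hPx0 : 0 ≤ P * x := mul_nonneg hP'.le hx.1
  have hPx1 : P * x ≤ P := mul_le_of_le_one_right hP'.le hx.2
  have hclose : |P * t - P * x| ≤ 1 / 4 := by
    rw [← mul_sub, abs_mul, abs_of_pos hP']
    exact (mul_le_mul_of_nonneg_left htx hP'.le).trans_eq (by field_simp)
  have hfloor : |P * x - k| ≤ 2 := by
    rw [mul_clamp hP] at hk
    obtain ⟨hlow, hup⟩ := hk
    rw [abs_le] at hclose ⊢
    rcases le_total (P * t) (P - 1 / 4) with h | h <;> grind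
  rw [show x - k / P = (P * x - k) / P by field_simp, abs_div, abs_of_pos hP']
  gcongr

end GoodCells

end ReLUCalculus

namespace HolderCube

open ReLUCalculus

open scoped Nat

variable {d : ℕ}

/-! ### Taylor expansion in the Hölder class -/

section Cube

variable {g : EuclideanSpace ℝ (Fin d) → ℝ} {x h : EuclideanSpace ℝ (Fin d)}

lemma convex_unitCube : Convex ℝ (unitCube d) := by
  intro x hx y hy a b ha hb hab i
  simpa using (convex_Icc (0 : ℝ) 1) (hx i) (hy i) ha hb hab

lemma interior_unitCube_nonempty : (interior (unitCube d)).Nonempty := by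
  have hopen : IsOpen {x : EuclideanSpace ℝ (Fin d) | ∀ i, x i ∈ Set.Ioo (0 : ℝ) 1} := by
    rw [Set.ofPred_forall]
    exact isOpen_iInter_of_finite fun i => isOpen_Ioo.preimage (by fun_prop)
  refine ⟨WithLp.toLp 2 fun _ => 1 / 2, interior_maximal (fun x hx i => ?_) hopen fun i => ?_⟩
  · exact Set.Ioo_subset_Icc_self (hx i)
  · norm_num

lemma uniqueDiffOn_unitCube : UniqueDiffOn ℝ (unitCube d) :=
  uniqueDiffOn_convex convex_unitCube interior_unitCube_nonempty

lemma unitCube_subset_closure_interior : unitCube d ⊆ closure (interior (unitCube d)) := by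
  rw [convex_unitCube.closure_interior_eq_closure_of_nonempty_interior interior_unitCube_nonempty]
  exact subset_closure

lemma mapsTo_segment_unitCube (hx : x ∈ unitCube d) (hxh : x + h ∈ unitCube d) :
    Set.MapsTo (fun t : ℝ => x + t • h) (Set.Icc 0 1) (unitCube d) := fun t ht => by
  simpa using convex_unitCube.add_smul_sub_mem hx hxh ht

lemma preimage_line_unitCube (hx : x ∈ unitCube d) (i : Fin d) :
    (fun t : ℝ => x + t • EuclideanSpace.single i (1 : ℝ)) ⁻¹' unitCube d =
      Set.Icc (-x i) (1 - x i) := by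
  ext t
  have hcoord : (x + t • EuclideanSpace.single i (1 : ℝ)) i = x i + t := by simp
  have hi : x i + t ∈ Set.Icc (0 : ℝ) 1 ↔ t ∈ Set.Icc (-x i) (1 - x i) := by
    simp only [Set.mem_Icc]
    constructor <;> rintro ⟨h0, h1⟩ <;> constructor <;> linarith
  refine ⟨fun h => hi.1 (hcoord ▸ h i), fun h j => ?_⟩
  rcases eq_or_ne j i with rfl | hj
  · exact hcoord ▸ hi.2 h
  · simpa [hj] using hx j

lemma cubePartial_eq_fderivWithin (hg : DifferentiableWithinAt ℝ g (unitCube d) x)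
    (hx : x ∈ unitCube d) (i : Fin d) :
    cubePartial i g x = fderivWithin ℝ g (unitCube d) x (EuclideanSpace.single i 1) := by
  refine HasDerivWithinAt.derivWithin
    (hg.hasFDerivWithinAt.hasLineDerivWithinAt (EuclideanSpace.single i 1)) ?_
  rw [preimage_line_unitCube hx]
  refine uniqueDiffOn_Icc (by linarith) 0 ⟨?_, ?_⟩ <;> linarith [(hx i).1, (hx i).2]

lemma cubePartial_congr {f : EuclideanSpace ℝ (Fin d) → ℝ} (h : Set.EqOn f g (unitCube d))
    (i : Fin d) : Set.EqOn (cubePartial i f) (cubePartial i g) (unitCube d) := fun _ hx =>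
  lineDerivWithin_congr' h hx

lemma contDiffOn_cubePartial {n : ℕ} (hg : ContDiffOn ℝ (n + 1 : ℕ) g (unitCube d)) (i : Fin d) :
    ContDiffOn ℝ n (cubePartial i g) (unitCube d) := by
  have hfderiv : ContDiffOn ℝ n
      (fun x => fderivWithin ℝ g (unitCube d) x (EuclideanSpace.single i 1)) (unitCube d) :=
    (hg.fderivWithin uniqueDiffOn_unitCube (by push_cast; exact le_rfl)).clm_apply contDiffOn_const
  exact hfderiv.congr fun x hx =>
    cubePartial_eq_fderivWithin (hg.differentiableOn (by simp) x hx) hx i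

lemma cubePartial_cubePartial (hg : ContDiffOn ℝ 2 g (unitCube d)) (i j : Fin d)
    (hx : x ∈ unitCube d) : cubePartial i (cubePartial j g) x =
      fderivWithin ℝ (fderivWithin ℝ g (unitCube d)) (unitCube d) x (EuclideanSpace.single i 1)
        (EuclideanSpace.single j 1) := by
  have hj : Set.EqOn (cubePartial j g)
      (fun x => fderivWithin ℝ g (unitCube d) x (EuclideanSpace.single j 1)) (unitCube d) :=
    fun x hx => cubePartial_eq_fderivWithin (hg.differentiableOn (by simp) x hx) hx j
  have hfderiv : ContDiffOn ℝ 1 (fderivWithin ℝ g (unitCube d)) (unitCube d) :=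
    hg.fderivWithin uniqueDiffOn_unitCube (by norm_num)
  have hsnd := (hfderiv.differentiableOn (by simp) x hx).hasFDerivWithinAt.clm_apply
    (hasFDerivWithinAt_const (EuclideanSpace.single j (1 : ℝ)) x (unitCube d))
  rw [cubePartial_congr hj i hx, cubePartial_eq_fderivWithin hsnd.differentiableWithinAt hx,
    hsnd.fderivWithin (uniqueDiffOn_unitCube x hx)]
  simp

lemma cubePartial_comm (hg : ContDiffOn ℝ 2 g (unitCube d)) (i j : Fin d) :
    Set.EqOn (cubePartial i (cubePartial j g)) (cubePartial j (cubePartial i g)) (unitCube d) := by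
  intro x hx
  rw [cubePartial_cubePartial hg i j hx, cubePartial_cubePartial hg j i hx]
  exact (hg x hx).isSymmSndFDerivWithinAt (by simp) uniqueDiffOn_unitCube
    (unitCube_subset_closure_interior hx) hx _ _

end Cube

section ListDeriv

variable {f : EuclideanSpace ℝ (Fin d) → ℝ} {x y h : EuclideanSpace ℝ (Fin d)} {l l' : List (Fin d)}
  {s : ℕ} {r B₀ : ℝ}

/-- The iterated partial derivative of `f` on the unit cube along a list of directions, the head of
the list being the last direction to be differentiated. -/
noncomputable def listDeriv (l : List (Fin d)) (f : EuclideanSpace ℝ (Fin d) → ℝ) :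
    EuclideanSpace ℝ (Fin d) → ℝ :=
  l.foldr cubePartial f

lemma contDiffOn_listDeriv : ∀ {l : List (Fin d)} {n : ℕ},
    ContDiffOn ℝ (n + l.length : ℕ) f (unitCube d) → ContDiffOn ℝ n (listDeriv l f) (unitCube d)
  | [], _, hf => hf
  | i :: _, n, hf =>
    contDiffOn_cubePartial (contDiffOn_listDeriv
      (by rwa [add_right_comm, add_assoc, ← List.length_cons (a := i)])) i

lemma listDeriv_perm (h : l.Perm l') (hf : ContDiffOn ℝ l.length f (unitCube d)) :
    Set.EqOn (listDeriv l f) (listDeriv l' f) (unitCube d) := by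
  induction h with
  | nil => exact Set.eqOn_refl _ _
  | cons i _ ih => exact cubePartial_congr (ih (hf.of_le (by simp))) i
  | swap i j l =>
    refine cubePartial_comm (g := listDeriv l f) (contDiffOn_listDeriv (n := 2) ?_) j i
    rwa [add_comm]
  | trans h₁ _ ih₁ ih₂ => exact (ih₁ hf).trans (ih₂ (by rwa [← h₁.length_eq]))

lemma cubeDeriv_eq_listDeriv (α : Fin d → ℕ) (f : EuclideanSpace ℝ (Fin d) → ℝ) :
    cubeDeriv α f = listDeriv ((List.finRange d).flatMap fun i => List.replicate (α i) i) f := by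
  have hiterate : ∀ (i : Fin d) (n : ℕ) (g : EuclideanSpace ℝ (Fin d) → ℝ),
      (cubePartial i)^[n] g = (List.replicate n i).foldr cubePartial g := by
    intro i n g
    induction n with
    | zero => rfl
    | succ n ih => rw [Function.iterate_succ_apply', ih, List.replicate_succ, List.foldr_cons]
  rw [listDeriv, List.foldr_flatMap, cubeDeriv]
  simp only [hiterate]

lemma sum_count_eq_length (l : List (Fin d)) : ∑ i, l.count i = l.length := by
  simpa using Multiset.sum_count_eq_card (s := Finset.univ) (m := (l : Multiset (Fin d)))

lemma listDeriv_eqOn_cubeDeriv (hf : ContDiffOn ℝ l.length f (unitCube d)) :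
    Set.EqOn (listDeriv l f) (cubeDeriv (fun i => l.count i) f) (unitCube d) := by
  rw [cubeDeriv_eq_listDeriv]
  refine listDeriv_perm (List.perm_iff_count.2 fun j => ?_) hf
  rw [List.count_flatMap, ← Fin.sum_univ_def]
  simp [List.count_replicate]

lemma abs_listDeriv_le (hf : f ∈ holderClass d s r B₀) (hl : l.length ≤ s) (hx : x ∈ unitCube d) :
    |listDeriv l f x| ≤ B₀ := by
  rw [listDeriv_eqOn_cubeDeriv (hf.1.of_le (mod_cast hl)) hx]
  exact hf.2.1 _ ((sum_count_eq_length l).trans_le hl) x hx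

lemma abs_listDeriv_sub_le (hf : f ∈ holderClass d s r B₀) (hl : l.length = s)
    (hx : x ∈ unitCube d) (hy : y ∈ unitCube d) :
    |listDeriv l f x - listDeriv l f y| ≤ B₀ * ‖x - y‖ ^ r := by
  have heq := listDeriv_eqOn_cubeDeriv (hf.1.of_le (mod_cast hl.le))
  rw [heq hx, heq hy]
  exact hf.2.2 _ ((sum_count_eq_length l).trans hl) x hx y hy

lemma clm_apply_eq_sum (T : EuclideanSpace ℝ (Fin d) →L[ℝ] ℝ) (h : EuclideanSpace ℝ (Fin d)) :
    T h = ∑ i, h i * T (EuclideanSpace.single i 1) := by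
  conv_lhs => rw [← (EuclideanSpace.basisFun (Fin d) ℝ).sum_repr h]
  simp

lemma hasDerivWithinAt_listDeriv (hf : ContDiffOn ℝ (l.length + 1 : ℕ) f (unitCube d))
    (hx : x ∈ unitCube d) (hxh : x + h ∈ unitCube d) {t : ℝ} (ht : t ∈ Set.Icc (0 : ℝ) 1) :
    HasDerivWithinAt (fun t => listDeriv l f (x + t • h))
      (∑ i, h i * listDeriv (i :: l) f (x + t • h)) (Set.Icc 0 1) t := by
  have hmaps := mapsTo_segment_unitCube hx hxh
  have hcont : ContDiffOn ℝ 1 (listDeriv l f) (unitCube d) :=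
    contDiffOn_listDeriv (n := 1) (by rwa [add_comm])
  have hdiff := hcont.differentiableOn (by simp) _ (hmaps ht)
  have hline : HasDerivWithinAt (fun t : ℝ => x + t • h) h (Set.Icc 0 1) t := by
    simpa using (((hasDerivAt_id t).smul_const h).const_add x).hasDerivWithinAt
  refine (hdiff.hasFDerivWithinAt.comp_hasDerivWithinAt t hline hmaps).congr_deriv ?_
  rw [clm_apply_eq_sum]
  exact Finset.sum_congr rfl fun i _ =>
    congrArg _ (cubePartial_eq_fderivWithin hdiff (hmaps ht) i).symm

end ListDeriv

section Taylor

variable {f : EuclideanSpace ℝ (Fin d) → ℝ} {x h : EuclideanSpace ℝ (Fin d)} {s : ℕ} {r B₀ : ℝ}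

lemma hasDerivAt_pow_div_factorial (k : ℕ) (t : ℝ) :
    HasDerivAt (fun t : ℝ => t ^ (k + 1) / (k + 1)!) (t ^ k / k !) t := by
  refine ((hasDerivAt_pow (k + 1) t).div_const _).congr_deriv ?_
  rw [Nat.factorial_succ]
  push_cast
  field_simp

lemma hasDerivWithinAt_taylor_remainder {s : ℕ} {G : ℕ → ℝ → ℝ} {t : ℝ}
    (hG : HasDerivWithinAt (G 0) (G 1 t) (Set.Icc 0 1) t) :
    HasDerivWithinAt (fun t => G 0 t - ∑ k ∈ Finset.range (s + 2), G k 0 * (t ^ k / k !))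
      (G 1 t - ∑ k ∈ Finset.range (s + 1), G (k + 1) 0 * (t ^ k / k !)) (Set.Icc 0 1) t := by
  simp only [Finset.sum_range_succ' _ (s + 1)]
  refine hG.sub ?_
  have hsum : HasDerivAt
      (fun t => ∑ k ∈ Finset.range (s + 1), G (k + 1) 0 * (t ^ (k + 1) / (k + 1)!))
      (∑ k ∈ Finset.range (s + 1), G (k + 1) 0 * (t ^ k / k !)) t :=
    HasDerivAt.fun_sum fun k _ => (hasDerivAt_pow_div_factorial k t).const_mul _
  simpa using (hsum.add_const (G 0 0)).hasDerivWithinAt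

lemma abs_sub_taylor_le {C : ℝ} (s : ℕ) : ∀ {G : ℕ → ℝ → ℝ},
    (∀ k < s, ∀ t ∈ Set.Icc (0 : ℝ) 1, HasDerivWithinAt (G k) (G (k + 1) t) (Set.Icc 0 1) t) →
    (∀ t ∈ Set.Icc (0 : ℝ) 1, |G s t - G s 0| ≤ C) → ∀ t ∈ Set.Icc (0 : ℝ) 1,
      |G 0 t - ∑ k ∈ Finset.range (s + 1), G k 0 * (t ^ k / k !)| ≤ C * (t ^ s / s !) := by
  induction s with
  | zero =>
    intro G _ hC t ht
    simpa using hC t ht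
  | succ s ih =>
    intro G hG hC t ht
    have hderiv_le := ih (G := fun k => G (k + 1)) (fun k hk => hG (k + 1) (by omega)) hC
    have hderiv := fun t ht => hasDerivWithinAt_taylor_remainder (s := s) (hG 0 (by omega) t ht)
    refine image_norm_le_of_norm_deriv_right_le_deriv_boundary
      (B' := fun t => C * (t ^ s / s !)) (fun t ht => (hderiv t ht).continuousWithinAt)
      (fun t ht => (hderiv t ⟨ht.1, ht.2.le⟩).mono_of_mem_nhdsWithin
        (Icc_mem_nhdsGE_of_mem ht))
      ?_ (fun t => (hasDerivAt_pow_div_factorial s t).const_mul C)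
      (fun t ht => hderiv_le t ⟨ht.1, ht.2.le⟩) ht
    simp [Finset.sum_range_succ' _ (s + 1)]

/-- The `k`-th derivative of `f` at `x` evaluated at `(h, …, h)`, that is, `k!` times the
homogeneous part of degree `k` of the Taylor polynomial of `f` at `x`. -/
noncomputable def taylorPart (f : EuclideanSpace ℝ (Fin d) → ℝ)
    (x h : EuclideanSpace ℝ (Fin d)) (k : ℕ) : ℝ :=
  ∑ σ : Fin k → Fin d, (∏ i, h (σ i)) * listDeriv (List.ofFn σ) f x

lemma taylorPart_zero : taylorPart f x h 0 = f x := by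
  simp [taylorPart, listDeriv]

lemma hasDerivWithinAt_taylorPart (hf : ContDiffOn ℝ s f (unitCube d)) (hx : x ∈ unitCube d)
    (hxh : x + h ∈ unitCube d) {k : ℕ} (hk : k < s) {t : ℝ} (ht : t ∈ Set.Icc (0 : ℝ) 1) :
    HasDerivWithinAt (fun t => taylorPart f (x + t • h) h k) (taylorPart f (x + t • h) h (k + 1))
      (Set.Icc 0 1) t := by
  have hsum := HasDerivWithinAt.fun_sum (u := (Finset.univ : Finset (Fin k → Fin d))) fun σ _ =>
    (hasDerivWithinAt_listDeriv (l := List.ofFn σ)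
      (hf.of_le (by rw [List.length_ofFn]; exact_mod_cast hk)) hx hxh ht).const_mul (∏ i, h (σ i))
  refine hsum.congr_deriv ?_
  rw [taylorPart, ← (Fin.consEquiv fun _ => Fin d).sum_comp, Fintype.sum_prod_type_right]
  refine Finset.sum_congr rfl fun σ _ => ?_
  rw [Finset.mul_sum]
  refine Finset.sum_congr rfl fun i _ => ?_
  simp only [Fin.consEquiv, Equiv.coe_fn_mk, Fin.prod_univ_succ, List.ofFn_succ, Fin.cons_zero,
    Fin.cons_succ]
  ring

lemma sum_abs_prod (h : EuclideanSpace ℝ (Fin d)) (k : ℕ) :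
    ∑ σ : Fin k → Fin d, |∏ i, h (σ i)| = (∑ i, |h i|) ^ k := by
  rw [Fintype.sum_pow]
  exact Finset.sum_congr rfl fun σ _ => Finset.abs_prod _ _

lemma abs_sum_prod_mul_le {k : ℕ} {c : (Fin k → Fin d) → ℝ} {C : ℝ} (hc : ∀ σ, |c σ| ≤ C)
    (h : EuclideanSpace ℝ (Fin d)) :
    |∑ σ : Fin k → Fin d, (∏ i, h (σ i)) * c σ| ≤ (∑ i, |h i|) ^ k * C := by
  rw [← sum_abs_prod, Finset.sum_mul]
  refine (Finset.abs_sum_le_sum_abs _ _).trans (Finset.sum_le_sum fun σ _ => ?_)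
  rw [abs_mul]
  exact mul_le_mul_of_nonneg_left (hc σ) (abs_nonneg _)

lemma abs_sub_taylor_sum_le (hB : 0 ≤ B₀) (hr : 0 ≤ r) (hf : f ∈ holderClass d s r B₀)
    (hx : x ∈ unitCube d) (hxh : x + h ∈ unitCube d) :
    |f (x + h) - ∑ k ∈ Finset.range (s + 1), taylorPart f x h k / k !| ≤
      (∑ i, |h i|) ^ s * (B₀ * ‖h‖ ^ r) / s ! := by
  have hremainder := abs_sub_taylor_le s (C := (∑ i, |h i|) ^ s * (B₀ * ‖h‖ ^ r))
    (G := fun k t => taylorPart f (x + t • h) h k)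
    (fun k hk t ht => hasDerivWithinAt_taylorPart hf.1 hx hxh hk ht) (fun t ht => ?_) 1 (by simp)
  · simpa only [taylorPart_zero, one_smul, zero_smul, add_zero, one_pow, mul_one_div]
      using hremainder
  · simp only [taylorPart, zero_smul, add_zero, ← Finset.sum_sub_distrib, ← mul_sub]
    refine abs_sum_prod_mul_le (fun σ => ?_) h
    refine (abs_listDeriv_sub_le hf (by simp) (mapsTo_segment_unitCube hx hxh ht) hx).trans ?_
    have : ‖x + t • h - x‖ ≤ ‖h‖ := by
      rw [add_sub_cancel_left, norm_smul, Real.norm_eq_abs, abs_of_nonneg ht.1]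
      exact mul_le_of_le_one_left (norm_nonneg _) ht.2
    gcongr

lemma abs_sub_le_of_one_le (hf : f ∈ holderClass d s r B₀) (hs : 1 ≤ s)
    (hx : x ∈ unitCube d) (hxh : x + h ∈ unitCube d) :
    |f (x + h) - f x| ≤ (∑ i, |h i|) * B₀ := by
  have hmvt := (convex_Icc (0 : ℝ) 1).norm_image_sub_le_of_norm_hasDerivWithin_le
    (f := fun t => taylorPart f (x + t • h) h 0) (C := (∑ i, |h i|) * B₀)
    (fun t ht => hasDerivWithinAt_taylorPart hf.1 hx hxh hs ht) (fun t ht => ?_)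
    (x := 0) (y := 1) (by simp) (by simp)
  · simpa [taylorPart_zero] using hmvt
  · exact (abs_sum_prod_mul_le (k := 0 + 1) (fun σ => abs_listDeriv_le hf
      (List.length_ofFn.trans_le hs) (mapsTo_segment_unitCube hx hxh ht)) h).trans_eq (by simp)

end Taylor

section QuantizedTaylor

variable {s : ℕ} {r B₀ : ℝ} {f : EuclideanSpace ℝ (Fin d) → ℝ} {h : EuclideanSpace ℝ (Fin d)}
  {a : ℝ}

lemma norm_le_sqrt_mul_of_abs_le (ha : 0 ≤ a) (hh : ∀ i, |h i| ≤ a) : ‖h‖ ≤ √d * a := by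
  calc ‖h‖ = √(∑ i, |h i| ^ 2) := EuclideanSpace.norm_eq h
    _ ≤ √(∑ _i : Fin d, a ^ 2) := by gcongr with i; exact hh i
    _ = √d * a := by simp [Real.sqrt_sq ha]

lemma sum_abs_le_mul_of_abs_le (hh : ∀ i, |h i| ≤ a) : ∑ i, |h i| ≤ d * a := by
  simpa using Finset.sum_le_card_nsmul Finset.univ (fun i => |h i|) a fun i _ => hh i

/-- The sequences of at most `s` directions in `ℝ^d`, which index the partial derivatives of order
at most `s`; permuted sequences give the same derivative but are kept apart. -/
abbrev MultiDir (d s : ℕ) : Type := Σ k : Fin (s + 1), (Fin k → Fin d)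

lemma card_multiDir_le (hd : 1 ≤ d) (s : ℕ) : Fintype.card (MultiDir d s) ≤ (s + 1) * d ^ s := by
  simp only [Fintype.card_sigma, Fintype.card_fun, Fintype.card_fin]
  calc ∑ k : Fin (s + 1), d ^ (k : ℕ) ≤ ∑ _k : Fin (s + 1), d ^ s :=
        Finset.sum_le_sum fun k _ => Nat.pow_le_pow_right hd (Fin.is_le k)
    _ = (s + 1) * d ^ s := by simp

/-- The partial derivatives of `f` at `c`, mapped affinely from `[-B₀, B₀]` to `[0, 1]`. -/
noncomputable def unitDeriv (B₀ : ℝ) (f : EuclideanSpace ℝ (Fin d) → ℝ)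
    (c : EuclideanSpace ℝ (Fin d)) (a : MultiDir d s) : ℝ :=
  (listDeriv (List.ofFn a.2) f c / B₀ + 1) / 2

/-- The Taylor polynomial with increment `h` of a function whose partial derivatives at the base
point, mapped affinely from `[-B₀, B₀]` to `[0, 1]`, are `v`. -/
noncomputable def taylorOf (B₀ : ℝ) (v : MultiDir d s → ℝ) (h : EuclideanSpace ℝ (Fin d)) : ℝ :=
  ∑ a, B₀ / (a.1 : ℕ)! * ((2 * v a - 1) * ∏ i, h (a.2 i))

variable {v w : MultiDir d s → ℝ} {c : EuclideanSpace ℝ (Fin d)} {τ : ℝ}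

lemma unitDeriv_mem_Icc (hB : 0 < B₀) (hf : f ∈ holderClass d s r B₀) (hc : c ∈ unitCube d)
    (a : MultiDir d s) : unitDeriv B₀ f c a ∈ Set.Icc (0 : ℝ) 1 := by
  have hbound : |listDeriv (List.ofFn a.2) f c / B₀| ≤ 1 := by
    rw [abs_div, abs_of_pos hB, div_le_one hB]
    exact abs_listDeriv_le hf (by simpa using Fin.is_le a.1) hc
  rw [abs_le] at hbound
  constructor <;> rw [unitDeriv] <;> linarith

lemma taylorOf_unitDeriv (hB : B₀ ≠ 0) :
    taylorOf B₀ (unitDeriv (s := s) B₀ f c) h =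
      ∑ k ∈ Finset.range (s + 1), taylorPart f c h k / k ! := by
  rw [Finset.sum_range, taylorOf, Fintype.sum_sigma]
  refine Finset.sum_congr rfl fun k _ => ?_
  rw [taylorPart, Finset.sum_div]
  refine Finset.sum_congr rfl fun σ _ => ?_
  rw [unitDeriv]
  field_simp
  ring

lemma abs_taylorOf_sub_taylorOf_le (hB : 0 ≤ B₀) (hh : ∀ i, h i ∈ Set.Icc (0 : ℝ) 1)
    (hvw : ∀ a, |v a - w a| ≤ τ) :
    |taylorOf B₀ v h - taylorOf B₀ w h| ≤ Fintype.card (MultiDir d s) * (2 * B₀ * τ) := by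
  rw [taylorOf, taylorOf, ← Finset.sum_sub_distrib, ← nsmul_eq_mul, ← Finset.card_univ]
  refine (Finset.abs_sum_le_sum_abs _ _).trans (Finset.sum_le_card_nsmul _ _ _ fun a _ => ?_)
  have hprod : (∏ i, h (a.2 i)) / (a.1 : ℕ)! ∈ Set.Icc (0 : ℝ) 1 := by
    have hprod0 : 0 ≤ ∏ i, h (a.2 i) := Finset.prod_nonneg fun i _ => (hh _).1
    have hprod1 : ∏ i, h (a.2 i) ≤ 1 := Finset.prod_le_one (fun i _ => (hh _).1) fun i _ => (hh _).2
    exact ⟨by positivity,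
      div_le_one_of_le₀ (hprod1.trans (mod_cast Nat.factorial_pos _)) (by positivity)⟩
  calc |B₀ / (a.1 : ℕ)! * ((2 * v a - 1) * ∏ i, h (a.2 i)) -
          B₀ / (a.1 : ℕ)! * ((2 * w a - 1) * ∏ i, h (a.2 i))|
      = |2 * B₀ * (v a - w a) * ((∏ i, h (a.2 i)) / (a.1 : ℕ)!)| := by congr 1; ring
    _ = 2 * B₀ * |v a - w a| * ((∏ i, h (a.2 i)) / (a.1 : ℕ)!) := by
        rw [abs_mul, abs_mul, abs_of_nonneg (by positivity : 0 ≤ 2 * B₀), abs_of_nonneg hprod.1]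
    _ ≤ 2 * B₀ * |v a - w a| := mul_le_of_le_one_right (by positivity) hprod.2
    _ ≤ 2 * B₀ * τ := by gcongr; exact hvw a

lemma abs_sub_taylorOf_le (hB : 0 < B₀) (hr : 0 ≤ r) (hf : f ∈ holderClass d s r B₀)
    (hc : c ∈ unitCube d) (hch : c + h ∈ unitCube d) (ha : a ∈ Set.Icc (0 : ℝ) 1)
    (hh : ∀ i, h i ∈ Set.Icc (0 : ℝ) a) (hv : ∀ b, |unitDeriv B₀ f c b - v b| ≤ τ) :
    |f (c + h) - taylorOf B₀ v h| ≤ (d * a) ^ s * (B₀ * (√d * a) ^ r) / s ! +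
      Fintype.card (MultiDir d s) * (2 * B₀ * τ) := by
  have habs : ∀ i, |h i| ≤ a := fun i => by rw [abs_of_nonneg (hh i).1]; exact (hh i).2
  have htaylor : |f (c + h) - taylorOf B₀ (unitDeriv (s := s) B₀ f c) h| ≤
      (d * a) ^ s * (B₀ * (√d * a) ^ r) / s ! := by
    rw [taylorOf_unitDeriv hB.ne']
    refine (abs_sub_taylor_sum_le hB.le hr hf hc hch).trans ?_
    have := ha.1
    gcongr
    · exact sum_abs_le_mul_of_abs_le habs
    · exact norm_le_sqrt_mul_of_abs_le ha.1 habs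
  exact (abs_sub_le _ _ _).trans (add_le_add htaylor
    (abs_taylorOf_sub_taylorOf_le hB.le (fun i => ⟨(hh i).1, (hh i).2.trans ha.2⟩) hv))

end QuantizedTaylor

/-! ### The approximating network -/

section TaylorNetwork

variable {s : ℕ} {r B₀ c δ τ : ℝ} {f : EuclideanSpace ℝ (Fin d) → ℝ} {p : Fin d → ℕ}
  {A B D K L P T e l n : ℕ}

/-- The point with coordinates `p i / P` of the grid of mesh `1 / P`. -/
noncomputable def gridPoint (P : ℕ) (p : Fin d → ℕ) : EuclideanSpace ℝ (Fin d) :=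
  WithLp.toLp 2 fun i => (p i : ℝ) / P

lemma gridPoint_mem_unitCube (hp : ∀ i, p i ≤ P) : gridPoint P p ∈ unitCube d := fun i =>
  ⟨by rw [gridPoint]; positivity, div_le_one_of_le₀ (mod_cast hp i) P.cast_nonneg⟩

lemma gridPoint_mul (hT : 0 < T) (p : Fin d → ℕ) : gridPoint (K * T) p =
    gridPoint K (fun i => p i / T) + gridPoint (K * T) fun i => p i % T := by
  ext i
  simp only [gridPoint, PiLp.add_apply, natCast_eq_mul_div_add_mod (p i) T, Nat.cast_mul, add_div]
  rw [mul_comm (K : ℝ), mul_div_mul_left _ _ (by positivity)]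

lemma gridPoint_mod_mem_Icc (hT : 0 < T) (p : Fin d → ℕ) (i : Fin d) :
    gridPoint (K * T) (fun i => p i % T) i ∈ Set.Icc (0 : ℝ) (1 / K) := by
  have hmod : ((p i % T : ℕ) : ℝ) / T ≤ 1 :=
    div_le_one_of_le₀ (mod_cast (Nat.mod_lt _ hT).le) T.cast_nonneg
  refine ⟨by rw [gridPoint]; positivity, ?_⟩
  calc ((p i % T : ℕ) : ℝ) / (K * T : ℕ) = ((p i % T : ℕ) : ℝ) / T / K := by
        rw [Nat.cast_mul, mul_comm, div_div]
    _ ≤ 1 / K := by gcongr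

lemma taylorOf_gridPoint_mul (B₀ : ℝ) (v : MultiDir d s → ℝ) (p : Fin d → ℕ) :
    taylorOf B₀ v (gridPoint (K * T) p) = ∑ a : MultiDir d s, B₀ / (a.1 : ℕ)! / K ^ (a.1 : ℕ) *
      (2 * ((∏ i, (p (a.2 i) : ℝ) / T) * v a) - ∏ i, (p (a.2 i) : ℝ) / T) := by
  refine Finset.sum_congr rfl fun a _ => ?_
  have hprod : ∏ i, gridPoint (K * T) p (a.2 i) = (∏ i, (p (a.2 i) : ℝ) / T) / K ^ (a.1 : ℕ) := by
    simp [gridPoint, Nat.cast_mul, div_mul_eq_div_div_swap, Finset.prod_div_distrib]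
  rw [hprod]
  ring

lemma computes_taylorOf_gridPoint {X : Type*} {S : Set (X → ℝ)} {W : ℕ} {p : X → Fin d → ℕ}
    {v : X → MultiDir d s → ℝ} (B₀ : ℝ) (h : ∀ a, Computes S W D
      {fun q => ∏ i, (p q (a.2 i) : ℝ) / T, fun q => (∏ i, (p q (a.2 i) : ℝ) / T) * v q a}) :
    Computes S (Fintype.card (MultiDir d s) * W) D
      {fun q => taylorOf B₀ (v q) (gridPoint (K * T) (p q))} := by
  refine (Computes.iUnion h).affine_comp ?_
  rintro _ rfl
  simp only [taylorOf_gridPoint_mul]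
  refine sum_mem_affSpan _ fun a _ => const_mul_mem_affSpan _ (sub_mem_affSpan
    (const_mul_mem_affSpan _ (mem_affSpan ?_)) (mem_affSpan ?_)) <;>
  exact Set.mem_iUnion_of_mem a (by simp)

lemma exists_computes_taylorOf {X : Type*} {x : Fin d → X → ℝ} {p : X → Fin d → ℕ}
    {y : (Fin d → ℕ) → MultiDir d s → ℝ} (B₀ : ℝ) (hd : 0 < d) (hA : 0 < A) (hB : 0 < B)
    (hn : 0 < n) (hc : 0 ≤ c) (hδ : 0 < δ) (hBl : B ≤ (2 * A) ^ l) (hKl : K ≤ (2 * A) ^ l)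
    (hKd : K ^ d ≤ A * (A * B ^ 2))
    (hD : 1 + l + 2 * L * s + (2 + l + (2 * B + 2 * (B * e))) ≤ D)
    (hy : ∀ m, (∀ i, m i < K) → ∀ a, y m a ∈ Set.Icc (0 : ℝ) 1)
    (hpP : ∀ q i, p q i < K * (2 * A) ^ L)
    (hp : ∀ q i, IsRobustFloor δ ((K * (2 * A) ^ L : ℕ) * clamp c (x i q)) (p q i)) :
    ∃ v : X → MultiDir d s → ℝ,
      (∀ q a, |y (fun i => p q i / (2 * A) ^ L) a - v q a| ≤ 1 / 2 ^ (n * e)) ∧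
      Computes (Set.range x) (Fintype.card (MultiDir d s) * (20 * d * A * n)) D
        {fun q => taylorOf B₀ (v q)
          (gridPoint (K * (2 * A) ^ L) fun i => p q i % (2 * A) ^ L)} := by
  have hT : 0 < (2 * A) ^ L := by positivity
  have hp' : ∀ q i, IsRobustFloor δ (((2 * A) ^ L : ℕ) * (K * clamp c (x i q))) (p q i) :=
    fun q i => by rw [← mul_assoc, ← Nat.cast_mul, mul_comm _ K]; exact hp q i
  have hcell : ∀ q i, p q i / (2 * A) ^ L < K := fun q i =>
    (Nat.div_lt_iff_lt_mul hT).2 (hpP q i)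
  have hterm := fun a : MultiDir d s => exists_computes_mul_cell_value (e := e)
    (m := fun q i => ⟨p q i / (2 * A) ^ L, hcell q i⟩) (y := fun m => y (fun i => m i) a)
    (p := fun i q => p q i % (2 * A) ^ L) hd hA hB hn hc (δ := δ / ((2 * A) ^ L : ℕ)) (δ' := δ)
    (by positivity) hδ hBl hKl hKd (fun m => hy _ (fun i => (m i).2) a)
    (fun i q => (hp' q i).div hT) (fun i q => Nat.mod_lt _ hT)
    (fun i q => by simpa using (hp' q i).mod) a.2
  choose v hv hv0 hcomp using hterm
  refine ⟨fun q a => v a q, fun q a => hv a q, ?_⟩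
  have hwidth : 2 ≤ 20 * d * A * n := by
    have : 0 < d * A * n := by positivity
    linarith
  refine computes_taylorOf_gridPoint B₀ fun a => ?_
  simp only [Nat.cast_pow]
  refine (hcomp a).delay ((encard_pair_le _ _).trans (mod_cast hwidth)) ?_ (le_trans ?_ hD)
  · rintro _ (rfl | rfl) q
    · positivity
    · exact mul_nonneg (by positivity) (hv0 a q)
  · have : (a.1 : ℕ) ≤ s := Fin.is_le a.1
    gcongr

lemma abs_sub_taylorOf_gridPoint_le {v : MultiDir d s → ℝ} (hB₀ : 0 < B₀) (hr : 0 ≤ r)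
    (hf : f ∈ holderClass d s r B₀) (hK : 0 < K) (hT : 0 < T) (hp : ∀ i, p i < K * T)
    (hv : ∀ a, |unitDeriv B₀ f (gridPoint K fun i => p i / T) a - v a| ≤ τ) :
    |f (gridPoint (K * T) p) - taylorOf B₀ v (gridPoint (K * T) fun i => p i % T)| ≤
      (d * (1 / K)) ^ s * (B₀ * (√d * (1 / K)) ^ r) / s ! +
        Fintype.card (MultiDir d s) * (2 * B₀ * τ) := by
  have hmesh : (1 : ℝ) / K ∈ Set.Icc (0 : ℝ) 1 :=
    ⟨by positivity, div_le_one_of_le₀ (mod_cast hK) K.cast_nonneg⟩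
  have hcorner : gridPoint K (fun i => p i / T) ∈ unitCube d :=
    gridPoint_mem_unitCube fun i => ((Nat.div_lt_iff_lt_mul hT).2 (hp i)).le
  have hpoint := gridPoint_mem_unitCube fun i => (hp i).le
  rw [gridPoint_mul hT] at hpoint ⊢
  exact abs_sub_taylorOf_le hB₀ hr hf hcorner hpoint hmesh (gridPoint_mod_mem_Icc hT p) hv

lemma exists_computes_approx_on_cellGood {Ω : ℝ} (hd : 0 < d) (hA : 0 < A) (hB : 0 < B)
    (hn : 0 < n) (hK : 0 < K) (hBl : B ≤ (2 * A) ^ l) (hKl : K ≤ (2 * A) ^ l)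
    (hKd : K ^ d ≤ A * (A * B ^ 2))
    (hD : 1 + l + 2 * L * s + (2 + l + (2 * B + 2 * (B * e))) ≤ D)
    (hB₀ : 0 < B₀) (hr : 0 ≤ r) (hf : f ∈ holderClass d s r B₀)
    (hP : P = K * (2 * A) ^ L)
    (hΩ : ∀ x ∈ unitCube d, ∀ y ∈ unitCube d, (∀ i, |x i - y i| ≤ 2 / P) → |f x - f y| ≤ Ω) :
    ∃ g : (Fin d → ℝ) → ℝ,
      Computes (coords d) (Fintype.card (MultiDir d s) * (20 * d * A * n)) D {g} ∧
      ∀ x : Fin d → ℝ, WithLp.toLp 2 x ∈ unitCube d → ∀ y : Fin d → ℝ,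
        (∀ i, |y i - x i| ≤ 1 / (4 * P) ∧ y i ∈ cellGood P) →
        |g y - f (WithLp.toLp 2 x)| ≤ (d * (1 / K)) ^ s * (B₀ * (√d * (1 / K)) ^ r) / s ! +
          Fintype.card (MultiDir d s) * (2 * B₀ * (1 / 2 ^ (n * e))) + Ω := by
  subst hP
  have hT : 0 < (2 * A) ^ L := by positivity
  have hP : 0 < K * (2 * A) ^ L := Nat.mul_pos hK hT
  have hc : (0 : ℝ) ≤ 1 - 1 / (4 * (K * (2 * A) ^ L : ℕ)) := by
    have : (1 : ℝ) ≤ (K * (2 * A) ^ L : ℕ) := mod_cast hP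
    exact sub_nonneg.2 (div_le_one_of_le₀ (by linarith) (by positivity))
  let X := {y : Fin d → ℝ // ∀ i, y i ∈ cellGood (K * (2 * A) ^ L)}
  choose p hpP hp using fun q : X => q.2
  obtain ⟨v, hv, hcomp⟩ := exists_computes_taylorOf (x := fun i (q : X) => q.1 i) (e := e)
    (y := fun m => unitDeriv B₀ f (gridPoint K m)) B₀ hd hA hB hn hc (by norm_num) hBl hKl hKd hD
    (fun m hm => unitDeriv_mem_Icc hB₀ hf (gridPoint_mem_unitCube fun i => (hm i).le)) hpP hp
  have hrange : Set.range (fun i (q : X) => q.1 i) = (· ∘ Subtype.val) '' coords d := by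
    rw [coords, ← Set.range_comp]
    rfl
  rw [hrange] at hcomp
  obtain ⟨T', hT', hsub⟩ := Computes.exists_lift _ hcomp
  obtain ⟨g, hg, hgv⟩ := hsub rfl
  refine ⟨g, hT'.anti (Set.singleton_subset_iff.2 hg), fun x hx y hy => ?_⟩
  let q : X := ⟨y, fun i => (hy i).2⟩
  have hclose : |f (WithLp.toLp 2 x) - f (gridPoint (K * (2 * A) ^ L) (p q))| ≤ Ω :=
    hΩ _ hx _ (gridPoint_mem_unitCube fun i => (hpP q i).le) fun i =>
      abs_sub_div_le_of_isRobustFloor hP (hx i) (hy i).1 (hp q i)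
  have htaylor := abs_sub_taylorOf_gridPoint_le hB₀ hr hf hK hT (hpP q) (hv q)
  have hgy : g y = taylorOf B₀ (v q)
      (gridPoint (K * (2 * A) ^ L) fun i => p q i % (2 * A) ^ L) := congrFun hgv q
  rw [hgy, abs_sub_comm, add_comm]
  exact (abs_sub_le _ _ _).trans (add_le_add hclose htaylor)

end TaylorNetwork

section Parameters

variable {s M N μ ν : ℕ}

lemma natCeil_logb_eight_mul (hN : 0 < N) : ⌈Real.logb 2 (8 * (N : ℝ))⌉₊ = Nat.clog 2 N + 3 := by
  have hlogb : Real.logb 2 (8 * (N : ℝ)) = Real.logb 2 N + (3 : ℕ) := by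
    rw [mul_comm, Real.logb_mul (by positivity) (by norm_num),
      show (8 : ℝ) = 2 ^ (3 : ℕ) by norm_num, Real.logb_pow, Real.logb_self_eq_one one_lt_two,
      mul_one]
  have hlogb0 : 0 ≤ Real.logb 2 N := Real.logb_nonneg one_lt_two (mod_cast hN)
  rw [hlogb, Nat.ceil_add_natCast hlogb0]
  congr 1
  exact_mod_cast Real.natCeil_logb_natCast 2 N

lemma nthRoot_pos {a n : ℕ} (hn : n ≠ 0) (ha : 0 < a) : 0 < Nat.nthRoot n a :=
  (Nat.le_nthRoot_iff hn).2 ((one_pow n).trans_le ha)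

lemma le_two_mul_nthRoot_pow {a n : ℕ} (hn : n ≠ 0) (ha : 0 < a) :
    a ≤ (2 * Nat.nthRoot n a) ^ n := by
  have := nthRoot_pos hn ha
  exact (Nat.lt_pow_nthRoot_add_one hn a).le.trans (Nat.pow_le_pow_left (by lia) n)

lemma mul_le_two_mul_pow (N : ℕ) (hM : M ≤ 2 ^ μ) : N * M ≤ (2 * N) ^ (μ + 1) := by
  calc N * M ≤ N ^ (μ + 1) * 2 ^ (μ + 1) := by
        gcongr
        · exact Nat.le_self_pow (by lia) N
        · exact hM.trans (Nat.pow_le_pow_right two_pos (by lia))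
    _ = (2 * N) ^ (μ + 1) := by rw [← mul_pow, mul_comm]

lemma mul_pow_le_two_pow (hN : N ≤ 2 ^ ν) (hM : M ≤ 2 ^ μ) (k : ℕ) :
    (N * M) ^ (2 * k) ≤ 2 ^ ((ν + 3) * (k * (μ + 3))) := by
  calc (N * M) ^ (2 * k) ≤ (2 ^ ν * 2 ^ μ) ^ (2 * k) := by gcongr
    _ = 2 ^ (2 * (ν + μ) * k) := by rw [← pow_add, ← pow_mul]; ring_nf
    _ ≤ 2 ^ ((ν + 3) * (μ + 3) * k) :=
        Nat.pow_le_pow_right two_pos (Nat.mul_le_mul_right _ (by nlinarith))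
    _ = 2 ^ ((ν + 3) * (k * (μ + 3))) := by ring_nf

lemma depth_le (hM : 0 < M) :
    1 + (μ + 1) * 2 + 2 * ((μ + 1) * (2 * (s + 1))) * s +
      (2 + (μ + 1) * 2 + (2 * M + 2 * (M * ((s + 1) * (μ + 3))))) ≤
      21 * (s + 1) ^ 2 * M * (μ + 3) := by
  set U := (s + 1) ^ 2 * M * (μ + 3)
  have hterm : ∀ {a b c : ℕ}, a ≤ (s + 1) ^ 2 → b ≤ M → c ≤ μ + 3 → a * b * c ≤ U :=
    fun ha hb hc => Nat.mul_le_mul (Nat.mul_le_mul ha hb) hc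
  have hs : s + 1 ≤ (s + 1) ^ 2 := Nat.le_self_pow two_ne_zero _
  have hdigits : 1 * 1 * (μ + 3) ≤ U := hterm (by lia) hM le_rfl
  have hextract : (s + 1) * s * 1 * (μ + 1) ≤ U := hterm (by nlinarith) hM (by lia)
  have hblocks : 1 * M * 3 ≤ U := hterm (by lia) le_rfl (by lia)
  have hbits : (s + 1) * M * (μ + 3) ≤ U := hterm hs le_rfl le_rfl
  calc _ = 4 * (1 * 1 * (μ + 3)) + 4 * ((s + 1) * s * 1 * (μ + 1)) + 2 * M +
        2 * ((s + 1) * M * (μ + 3)) - 5 := by ring_nf; lia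
    _ ≤ 21 * U := by lia
    _ = 21 * (s + 1) ^ 2 * M * (μ + 3) := by simp only [U]; ring

lemma card_multiDir_mul_le (hd : 1 ≤ d) (n : ℕ) :
    Fintype.card (MultiDir d s) * (20 * d * N * n) ≤
      38 * (s + 1) ^ 2 * d ^ (s + 1) * N * n := by
  calc Fintype.card (MultiDir d s) * (20 * d * N * n)
      ≤ ((s + 1) * d ^ s) * (20 * d * N * n) := by gcongr; exact card_multiDir_le hd s
    _ = 20 * (s + 1) * d ^ (s + 1) * N * n := by ring
    _ ≤ 38 * (s + 1) ^ 2 * d ^ (s + 1) * N * n := by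
        gcongr ?_ * _ * _ * _
        nlinarith

lemma three_le_width (hd : 1 ≤ d) (hN : 1 ≤ N) (ν : ℕ) :
    3 ≤ 38 * (s + 1) ^ 2 * d ^ (s + 1) * N * (ν + 3) :=
  (Nat.le_add_left 3 ν).trans (Nat.le_mul_of_pos_left _ (by positivity))

end Parameters

section Rate

variable {s : ℕ} {r β B₀ Z : ℝ} {f : EuclideanSpace ℝ (Fin d) → ℝ}

/-- The error rate `B₀ d^(s + max β 1 / 2) Z^(-2β/d)`, where `Z` stands for the product `N M` of
the width and depth parameters. -/
noncomputable def rate (d s : ℕ) (β B₀ Z : ℝ) : ℝ :=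
  B₀ * (d : ℝ) ^ ((s : ℝ) + max β 1 / 2) * Z ^ (-2 * β / (d : ℝ))

lemma rate_nonneg (hB₀ : 0 ≤ B₀) (hZ : 0 ≤ Z) : 0 ≤ rate d s β B₀ Z := by
  unfold rate
  positivity

lemma two_pow_le_two_mul_factorial : ∀ s : ℕ, 2 ^ s ≤ 2 * s !
  | 0 => by norm_num
  | 1 => by norm_num
  | s + 2 => by
    have := two_pow_le_two_mul_factorial (s + 1)
    rw [pow_succ, Nat.factorial_succ]
    nlinarith

lemma two_rpow_le_four_mul_factorial (hβ : β ≤ s + 1) : (2 : ℝ) ^ β ≤ 4 * s ! := by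
  calc (2 : ℝ) ^ β ≤ 2 ^ ((s + 1 : ℕ) : ℝ) :=
        Real.rpow_le_rpow_of_exponent_le one_le_two (by push_cast; exact hβ)
    _ = 2 * 2 ^ s := by rw [Real.rpow_natCast, pow_succ']
    _ ≤ 2 * (2 * s !) := by gcongr; exact_mod_cast two_pow_le_two_mul_factorial s
    _ = 4 * s ! := by ring

lemma one_div_rpow_le_of_sq_le {K : ℝ} (hd : d ≠ 0) (hZ : 0 < Z) (hK : 0 < K) (hβ : 0 ≤ β)
    (h : Z ^ 2 ≤ (2 * K) ^ d) : (1 / K) ^ β ≤ 2 ^ β * Z ^ (-2 * β / (d : ℝ)) := by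
  have hroot : Z ^ (2 / (d : ℝ)) ≤ 2 * K := by
    rw [div_eq_mul_inv, Real.rpow_mul hZ.le, Real.rpow_two]
    exact (Real.rpow_le_rpow (by positivity) h (by positivity)).trans_eq
      (Real.pow_rpow_inv_natCast (by positivity) hd)
  have hK_inv : 1 / K ≤ 2 * Z ^ (-2 / (d : ℝ)) := by
    rw [neg_div, Real.rpow_neg hZ.le, ← div_eq_mul_inv, div_le_div_iff₀ hK (by positivity), one_mul]
    exact hroot
  calc (1 / K) ^ β ≤ (2 * Z ^ (-2 / (d : ℝ))) ^ β := by gcongr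
    _ = 2 ^ β * Z ^ (-2 * β / (d : ℝ)) := by
        rw [Real.mul_rpow two_pos.le (by positivity), ← Real.rpow_mul hZ.le, div_mul_eq_mul_div]

lemma one_div_rpow_le_of_pow_le {Q γ : ℝ} {k : ℕ} (hd : 1 ≤ d) (hZ : 1 ≤ Z) (hγ : 0 ≤ γ)
    (hβ0 : 0 ≤ β) (hβ : β ≤ k * γ) (h : Z ^ (2 * k) ≤ Q) :
    (1 / Q) ^ γ ≤ Z ^ (-2 * β / (d : ℝ)) := by
  have hZ0 : 0 < Z := by linarith
  have hexp : -(2 * (k * γ)) ≤ -2 * β / (d : ℝ) := by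
    have hdiv : β / d ≤ β := div_le_self hβ0 (mod_cast hd)
    rw [mul_div_assoc]
    linarith
  calc (1 / Q) ^ γ ≤ (1 / Z ^ (2 * k)) ^ γ := by
        have : 0 < Q := lt_of_lt_of_le (by positivity) h
        gcongr
    _ = Z ^ (-(2 * (k * γ))) := by
        rw [one_div, ← Real.rpow_natCast, ← Real.rpow_neg hZ0.le, ← Real.rpow_mul hZ0.le]
        push_cast
        ring_nf
    _ ≤ Z ^ (-2 * β / (d : ℝ)) := Real.rpow_le_rpow_of_exponent_le hZ hexp

lemma natCast_rpow_le (hd : 1 ≤ d) {γ : ℝ} (hγ : γ ≤ s + 1 / 2) :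
    (d : ℝ) ^ γ ≤ (d : ℝ) ^ ((s : ℝ) + max β 1 / 2) :=
  Real.rpow_le_rpow_of_exponent_le (mod_cast hd) (by linarith [le_max_right β 1])

lemma pow_mul_sqrt_rpow_le (hd : 1 ≤ d) (hr1 : r ≤ 1) :
    (d : ℝ) ^ s * √d ^ r ≤ (d : ℝ) ^ ((s : ℝ) + max β 1 / 2) := by
  have hd0 : (0 : ℝ) < d := mod_cast hd
  rw [Real.sqrt_eq_rpow, ← Real.rpow_mul hd0.le, ← Real.rpow_natCast, ← Real.rpow_add hd0]
  exact natCast_rpow_le hd (by linarith)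

lemma taylor_error_le {K : ℝ} (hd : 1 ≤ d) (hr0 : 0 < r) (hr1 : r ≤ 1) (hβ : β = s + r)
    (hB₀ : 0 < B₀) (hZ : 0 < Z) (hK : 0 < K) (h : Z ^ 2 ≤ (2 * K) ^ d) :
    (d * (1 / K)) ^ s * (B₀ * (√d * (1 / K)) ^ r) / s ! ≤ 4 * rate d s β B₀ Z := by
  have hK_pow : (1 / K) ^ s * (1 / K) ^ r ≤ (4 * s !) * Z ^ (-2 * β / (d : ℝ)) := by
    rw [← Real.rpow_natCast, ← Real.rpow_add (by positivity), ← hβ]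
    refine (one_div_rpow_le_of_sq_le (by lia) hZ hK (by rw [hβ]; positivity) h).trans ?_
    gcongr
    exact two_rpow_le_four_mul_factorial (by linarith)
  rw [div_le_iff₀ (by positivity)]
  calc (d * (1 / K)) ^ s * (B₀ * (√d * (1 / K)) ^ r)
      = B₀ * ((d : ℝ) ^ s * √d ^ r) * ((1 / K) ^ s * (1 / K) ^ r) := by
        rw [mul_pow, Real.mul_rpow (by positivity) (by positivity)]
        ring
    _ ≤ B₀ * (d : ℝ) ^ ((s : ℝ) + max β 1 / 2) * ((4 * s !) * Z ^ (-2 * β / (d : ℝ))) := by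
        gcongr
        exact pow_mul_sqrt_rpow_le hd hr1
    _ = 4 * rate d s β B₀ Z * s ! := by rw [rate]; ring

lemma quantization_error_le {Q : ℝ} (hd : 1 ≤ d) (hβ0 : 0 ≤ β) (hβ : β ≤ s + 1) (hB₀ : 0 ≤ B₀)
    (hZ : 1 ≤ Z) (hQ : Z ^ (2 * (s + 1)) ≤ Q) :
    Fintype.card (MultiDir d s) * (2 * B₀ * (1 / Q)) ≤ 2 * (s + 1) * rate d s β B₀ Z := by
  have hcard : (Fintype.card (MultiDir d s) : ℝ) ≤ (s + 1) * d ^ ((s : ℝ) + max β 1 / 2) := by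
    calc (Fintype.card (MultiDir d s) : ℝ) ≤ (s + 1) * d ^ (s : ℝ) := by
          rw [Real.rpow_natCast]
          exact_mod_cast card_multiDir_le hd s
      _ ≤ (s + 1) * d ^ ((s : ℝ) + max β 1 / 2) := by
          gcongr ?_ * ?_
          exact natCast_rpow_le hd (by linarith)
  have hQ_inv : 1 / Q ≤ Z ^ (-2 * β / (d : ℝ)) := by
    simpa using one_div_rpow_le_of_pow_le (γ := 1) (k := s + 1) hd hZ zero_le_one hβ0
      (by push_cast; linarith) hQ
  have : 0 < Z := by linarith
  have : 0 < Q := lt_of_lt_of_le (by positivity) hQ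
  calc Fintype.card (MultiDir d s) * (2 * B₀ * (1 / Q))
      ≤ ((s + 1) * d ^ ((s : ℝ) + max β 1 / 2)) * (2 * B₀ * Z ^ (-2 * β / (d : ℝ))) := by
        gcongr
    _ = 2 * (s + 1) * rate d s β B₀ Z := by rw [rate]; ring

section Modulus

variable {P : ℝ} {x y : EuclideanSpace ℝ (Fin d)}

lemma abs_sub_le_rate_of_eq_zero (hd : 1 ≤ d) (hr0 : 0 < r) (hr1 : r ≤ 1) (hB₀ : 0 < B₀)
    (hf : f ∈ holderClass d 0 r B₀) (hZ : 1 ≤ Z) (hP : Z ^ 2 ≤ P) (hx : x ∈ unitCube d)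
    (hy : y ∈ unitCube d) (hxy : ∀ i, |x i - y i| ≤ 2 / P) :
    |f x - f y| ≤ 2 * rate d 0 r B₀ Z := by
  have hP0 : 0 < P := lt_of_lt_of_le (by positivity) hP
  have hholder : |f x - f y| ≤ B₀ * ‖x - y‖ ^ r := by
    simpa [listDeriv] using abs_listDeriv_sub_le (l := []) hf rfl hx hy
  have hnorm : ‖x - y‖ ≤ √d * (2 / P) := norm_le_sqrt_mul_of_abs_le (by positivity) hxy
  have hP_inv : (1 / P) ^ r ≤ Z ^ (-2 * r / (d : ℝ)) :=
    one_div_rpow_le_of_pow_le (k := 1) hd hZ hr0.le hr0.le (by simp) (by simpa using hP)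
  have hsqrt : √d ^ r ≤ (d : ℝ) ^ (((0 : ℕ) : ℝ) + max r 1 / 2) := by
    simpa using pow_mul_sqrt_rpow_le (s := 0) (β := r) hd hr1
  have htwo : (2 : ℝ) ^ r ≤ 2 := by
    simpa using Real.rpow_le_rpow_of_exponent_le one_le_two hr1
  calc |f x - f y| ≤ B₀ * (√d * (2 / P)) ^ r := hholder.trans (by gcongr)
    _ = B₀ * √d ^ r * (2 ^ r * (1 / P) ^ r) := by
        rw [Real.mul_rpow (by positivity) (by positivity), div_eq_mul_one_div 2 P,
          Real.mul_rpow two_pos.le (by positivity), mul_assoc]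
    _ ≤ B₀ * (d : ℝ) ^ (((0 : ℕ) : ℝ) + max r 1 / 2) * (2 * Z ^ (-2 * r / (d : ℝ))) := by gcongr
    _ = 2 * rate d 0 r B₀ Z := by rw [rate]; ring

lemma abs_sub_le_rate_of_one_le (hd : 1 ≤ d) (hs : 1 ≤ s) (hβ0 : 0 ≤ β) (hβ : β ≤ s + 1)
    (hB₀ : 0 ≤ B₀) (hf : f ∈ holderClass d s r B₀) (hZ : 1 ≤ Z) (hP : Z ^ (2 * (s + 1)) ≤ P)
    (hx : x ∈ unitCube d) (hy : y ∈ unitCube d) (hxy : ∀ i, |x i - y i| ≤ 2 / P) :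
    |f x - f y| ≤ 2 * rate d s β B₀ Z := by
  have hlipschitz : |f x - f y| ≤ (∑ i, |(x - y) i|) * B₀ := by
    simpa using abs_sub_le_of_one_le hf hs hy (h := x - y) (by simpa using hx)
  have hsum : ∑ i, |(x - y) i| ≤ d * (2 / P) := sum_abs_le_mul_of_abs_le hxy
  have hd_le : (d : ℝ) ≤ (d : ℝ) ^ ((s : ℝ) + max β 1 / 2) := by
    have : (1 : ℝ) ≤ s := mod_cast hs
    simpa using natCast_rpow_le (γ := 1) (β := β) (s := s) hd (by linarith)
  have hP_inv : 1 / P ≤ Z ^ (-2 * β / (d : ℝ)) := by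
    simpa using one_div_rpow_le_of_pow_le (γ := 1) (k := s + 1) hd hZ zero_le_one hβ0
      (by push_cast; linarith) hP
  have : 0 < Z := by linarith
  have : 0 < P := lt_of_lt_of_le (by positivity) hP
  calc |f x - f y| ≤ d * (2 / P) * B₀ := hlipschitz.trans (by gcongr)
    _ = B₀ * d * (2 * (1 / P)) := by ring
    _ ≤ B₀ * (d : ℝ) ^ ((s : ℝ) + max β 1 / 2) * (2 * Z ^ (-2 * β / (d : ℝ))) := by gcongr
    _ = 2 * rate d s β B₀ Z := by rw [rate]; ring

lemma abs_sub_le_rate (hd : 1 ≤ d) (hr0 : 0 < r) (hr1 : r ≤ 1) (hβ : β = s + r)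
    (hB₀ : 0 < B₀) (hf : f ∈ holderClass d s r B₀) (hZ : 1 ≤ Z) (hP : Z ^ (2 * (s + 1)) ≤ P)
    (hx : x ∈ unitCube d) (hy : y ∈ unitCube d) (hxy : ∀ i, |x i - y i| ≤ 2 / P) :
    |f x - f y| ≤ 2 * rate d s β B₀ Z := by
  subst hβ
  rcases Nat.eq_zero_or_pos s with rfl | hs
  · simpa using abs_sub_le_rate_of_eq_zero hd hr0 hr1 hB₀ hf hZ (by simpa using hP) hx hy hxy
  · exact abs_sub_le_rate_of_one_le hd hs (by positivity) (by linarith) hB₀.le hf hZ hP hx hy hxy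

end Modulus

lemma total_error_le (hB₀ : 0 ≤ B₀) (hZ : 0 ≤ Z) :
    4 * rate d s β B₀ Z + 2 * (s + 1) * rate d s β B₀ Z + 2 * rate d s β B₀ Z ≤
      19 * B₀ * ((s : ℝ) + 1) ^ 2 * (d : ℝ) ^ ((s : ℝ) + max β 1 / 2) *
        Z ^ (-2 * β / (d : ℝ)) := by
  calc _ = (4 + 2 * ((s : ℝ) + 1) + 2) * rate d s β B₀ Z := by ring
    _ ≤ 19 * ((s : ℝ) + 1) ^ 2 * rate d s β B₀ Z := by
        have : (0 : ℝ) ≤ s := s.cast_nonneg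
        have := rate_nonneg (d := d) (s := s) (β := β) hB₀ hZ
        gcongr
        nlinarith
    _ = _ := by rw [rate]; ring

end Rate

section Main

variable {s M N : ℕ} {r β B₀ : ℝ} {f : EuclideanSpace ℝ (Fin d) → ℝ}

lemma exists_computes_rate_approx_on_cellGood (hd : 1 ≤ d) (hr0 : 0 < r) (hr1 : r ≤ 1)
    (hβ : β = s + r) (hB₀ : 0 < B₀) (hf : f ∈ holderClass d s r B₀) (hM : 1 ≤ M) (hN : 1 ≤ N) :
    ∃ P : ℕ, 0 < P ∧ ∃ g : (Fin d → ℝ) → ℝ,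
      Computes (coords d) (38 * (s + 1) ^ 2 * d ^ (s + 1) * N * (Nat.clog 2 N + 3))
        (21 * (s + 1) ^ 2 * M * (Nat.clog 2 M + 3)) {g} ∧
      ∀ x : Fin d → ℝ, WithLp.toLp 2 x ∈ unitCube d → ∀ y : Fin d → ℝ,
        (∀ i, |y i - x i| ≤ 1 / (4 * P) ∧ y i ∈ cellGood P) →
        |g y - f (WithLp.toLp 2 x)| ≤ 4 * rate d s β B₀ (N * M) +
          2 * (s + 1) * rate d s β B₀ (N * M) + 2 * rate d s β B₀ (N * M) := by
  have hN2 : N ≤ 2 ^ Nat.clog 2 N := Nat.le_pow_clog one_lt_two N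
  have hM2 : M ≤ 2 ^ Nat.clog 2 M := Nat.le_pow_clog one_lt_two M
  set μ := Nat.clog 2 M
  have hNM : 0 < N * M := Nat.mul_pos hN hM
  have hZ : (1 : ℝ) ≤ N * M := mod_cast hNM
  have hd0 : d ≠ 0 := by lia
  have hdigits : N * M ≤ (2 * N) ^ (μ + 1) := mul_le_two_mul_pow N hM2
  have hsq : (N * M) ^ 2 ≤ (2 * N) ^ ((μ + 1) * 2) := by rw [pow_mul]; gcongr
  set K := Nat.nthRoot d ((N * M) ^ 2)
  have hK : 0 < K := nthRoot_pos hd0 (by positivity)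
  have hKd : K ^ d ≤ (N * M) ^ 2 := Nat.pow_nthRoot_le (Or.inl hd0)
  have hK2 : ((N * M : ℝ)) ^ 2 ≤ (2 * K) ^ d :=
    mod_cast le_two_mul_nthRoot_pow hd0 (a := (N * M) ^ 2) (by positivity)
  have hP : (N * M : ℝ) ^ (2 * (s + 1)) ≤ (K * (2 * N) ^ ((μ + 1) * (2 * (s + 1))) : ℕ) := by
    have : (N * M) ^ (2 * (s + 1)) ≤ (2 * N) ^ ((μ + 1) * (2 * (s + 1))) := by
      rw [pow_mul (2 * N)]; gcongr
    exact_mod_cast this.trans (Nat.le_mul_of_pos_left _ hK)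
  obtain ⟨g, hg, happrox⟩ := exists_computes_approx_on_cellGood (A := N) (B := M)
    (l := (μ + 1) * 2) (e := (s + 1) * (μ + 3)) (n := Nat.clog 2 N + 3) hd hN hM (by lia) hK
    (((Nat.le_mul_of_pos_left M hN).trans (Nat.le_self_pow two_ne_zero _)).trans hsq)
    (((Nat.le_self_pow hd0 K).trans hKd).trans hsq) (hKd.trans_eq (by ring)) (depth_le hM)
    hB₀ hr0.le hf rfl fun x hx y hy => abs_sub_le_rate hd hr0 hr1 hβ hB₀ hf hZ hP hx hy
  refine ⟨_, by positivity, g, hg.mono_width (card_multiDir_mul_le hd _), fun x hx y hy =>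
    (happrox x hx y hy).trans (add_le_add_left (add_le_add ?_ ?_) _)⟩
  · exact taylor_error_le hd hr0 hr1 hβ hB₀ (by positivity) (mod_cast hK) hK2
  · exact quantization_error_le hd (by rw [hβ]; positivity) (by linarith) hB₀.le hZ
      (mod_cast mul_pow_le_two_pow hN2 hM2 (s + 1))

end Main

end HolderCube

open ReLUCalculus HolderCube

theorem corollary3p2 (d : ℕ) (hd : 1 ≤ d) (β r B₀ : ℝ) (s : ℕ)
    (hr0 : 0 < r) (hr1 : r ≤ 1) (hβ : β = s + r) (hB₀ : 0 < B₀)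
    (f : EuclideanSpace ℝ (Fin d) → ℝ) (hf : f ∈ holderClass d s r B₀)
    (M N : ℕ) (hM : 1 ≤ M) (hN : 1 ≤ N) :
    ∃ φ : ReLUNet 1 d,
      φ.width =
        38 * (s + 1) ^ 2 * 3 ^ d * d ^ (s + 1) * N * ⌈Real.logb 2 (8 * (N : ℝ))⌉₊ ∧
      φ.depth = 21 * (s + 1) ^ 2 * M * ⌈Real.logb 2 (8 * (M : ℝ))⌉₊ + 2 * d ∧
      ∀ x ∈ unitCube d,
        |f x - φ.eval (fun i => x i) 0| ≤
          19 * B₀ * ((s : ℝ) + 1) ^ 2 * (d : ℝ) ^ ((s : ℝ) + (max β 1) / 2) *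
            ((N : ℝ) * (M : ℝ)) ^ (-2 * β / (d : ℝ)) := by
  obtain ⟨P, hP, g, hg, happrox⟩ :=
    exists_computes_rate_approx_on_cellGood hd hr0 hr1 hβ hB₀ hf hM hN
  obtain ⟨F, hF, hFf⟩ := exists_computes_approx_of_approx_on_good
    (C := {x | WithLp.toLp 2 x ∈ unitCube d}) (F := fun x => f (WithLp.toLp 2 x))
    (three_le_width hd hN _) hg (by positivity) (atLeastTwo_mem_cellGood hP) happrox
  obtain ⟨φ, hwidth, hdepth, heval⟩ := hF.exists_net (by lia)
  rw [natCeil_logb_eight_mul hN, natCeil_logb_eight_mul hM]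
  refine ⟨φ, by rw [hwidth]; ring, hdepth, fun x hx => ?_⟩
  rw [heval, abs_sub_comm]
  exact (hFf (fun i => x i) hx).trans (total_error_le hB₀.le (by positivity))
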